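/- \textbf{Setting.} Let $(X,d)$ be a geodesic metric space. A geodesic segment $\gamma$ is \emph{$r$-thin} if for every geodesic quadrangle $(\gamma_1,\gamma_2,\gamma_3,\gamma_4)$ (degenerate sides allowed) such that $\gamma$ is a subsegment of $\gamma_1$, the set $\gamma_2\cup\gamma_3\cup\gamma_4$ meets the closed $r$-ball around the midpoint of $\gamma$. A \emph{full contraction gauge} is a non-decreasing function $K:\mathbb{R}_{\ge 0}\to\mathbb{R}_{\ge 0}$ with $K(r)\ge 4r+1$ for all $r$. A pair $(x,y)\in X\times X$ is \emph{$K$-anti-contracting} if $d(x,y)\ge 1$ and, for all $r\ge 0$ and all geodesics $\gamma$ from $x$ to $y$, no subsegment of $\gamma$ of length at least $K(r)$ is $r$-thin. The \emph{$K$-contraction space} $\hat X_K$ is obtained from $X$ by gluing, for every $K$-anti-contracting pair $(x,y)$, an interval of length one along its endpoints to $x$ and $y$; it carries the induced path metric. For $K(r)=10r+1$ it is denoted by $\hat X$ and called the contraction space. An isometric action of a group $G$ on $X$ induces an isometric action of $G$ on $\hat X_K$. Let $G$ act by isometries on a metric space $Y$ and let $g\in G$. \begin{itemize} \item $g$ is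 \emph{loxodromic} on $Y$ if for some $y\in Y$ the map $\mathbb{Z}\to Y$, $n\mapsto g^n y$, is a quasi-isometric embedding. \item $g$ is \emph{WPD} on $Y$ if it is loxodromic on $Y$ and for all $y\in Y$ and $R>0$ there is $N\in\mathbb{N}$ such that $\{h\in G : d(y,hy)<R,\ d(g^Ny,hg^Ny)<R\}$ is finite. \item $g$ is \emph{strongly contracting} on $Y$ if it is loxodromic on $Y$ and, for some constant $C\geq 1$, stabilises a bi-infinite continuous $C$-quasi-geodesic $\gamma$ which is $C$-contracting, that is, the closest point projection to $\gamma$ of each open ball $B(x,d(x,\gamma))$, $x\in Y$, has diameter at most $C$. \end{itemize} \textbf{Theorem.} Let $G$ be a finitely generated group acting geometrically (by isometries, metrically properly and coboundedly) on a geodesic metric space $X$, let $K$ be a full contraction gauge, and let $g\in G$. The following are equivalent: \begin{enumerate} \item $g$ is loxodromic on $\hat X_K$; \item $g$ is WPD on $\hat X_K$; \item $g$ is strongly contracting on $X$. \end{enumerate} This applies in particular to the contraction space $\hat X$, i.e. to the full contraction gauge $K(r)=10r+1$. -/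

import Mathlib

open scoped NNReal ENNReal

section Geodesics

variable {X : Type*} [MetricSpace X]

/-- `γ` restricted to the interval `[a, b]` is a geodesic segment parametrised by arc length. -/
def IsGeodesicOn (γ : ℝ → X) (a b : ℝ) : Prop :=
  a ≤ b ∧ ∀ s ∈ Set.Icc a b, ∀ t ∈ Set.Icc a b, dist (γ s) (γ t) = |s - t|

/-- `γ`, restricted to `[0, d(x, y)]`, is a geodesic from `x` to `y`. -/
def IsGeodesicFromTo (γ : ℝ → X) (x y : X) : Prop :=
  IsGeodesicOn γ 0 (dist x y) ∧ γ 0 = x ∧ γ (dist x y) = y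

/-- The image of a geodesic from `x` to `y`. -/
def geodesicImage (γ : ℝ → X) (x y : X) : Set X := γ '' Set.Icc 0 (dist x y)

/-- A geodesic metric space: any two points are joined by a geodesic. -/
def IsGeodesicSpace (X : Type*) [MetricSpace X] : Prop :=
  ∀ x y : X, ∃ γ : ℝ → X, IsGeodesicFromTo γ x y

/-- The geodesic segment `γ|[a, b]` is `r`-thin: for every geodesic quadrangle
`(γ₁, γ₂, γ₃, γ₄)` such that `γ|[a, b]` is a subsegment of `γ₁`, the union of the three other
sides meets the closed `r`-ball around the midpoint of `γ|[a, b]`.  The side `γ₁` is defined on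
`[c, d] ⊇ [a, b]`, and `z`, `w` are the two remaining vertices (degenerate sides are allowed). -/
def IsThin (r : ℝ) (γ : ℝ → X) (a b : ℝ) : Prop :=
  ∀ (γ₁ γ₂ γ₃ γ₄ : ℝ → X) (c d : ℝ) (z w : X),
    c ≤ a → b ≤ d → IsGeodesicOn γ₁ c d → Set.EqOn γ₁ γ (Set.Icc a b) →
    IsGeodesicFromTo γ₂ (γ₁ d) z → IsGeodesicFromTo γ₃ z w → IsGeodesicFromTo γ₄ w (γ₁ c) →
    ∃ p ∈ geodesicImage γ₂ (γ₁ d) z ∪ geodesicImage γ₃ z w ∪ geodesicImage γ₄ w (γ₁ c),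
      dist p (γ ((a + b) / 2)) ≤ r

/-- The set of closest points of `S` to `x`. -/
def closestPoints (S : Set X) (x : X) : Set X :=
  {p | p ∈ S ∧ dist x p = Metric.infDist x S}

/-- `S` is `D`-contracting: the closest point projection to `S` of every open ball
`B(x, d(x, S))` has diameter at most `D`. -/
def IsContracting (D : ℝ) (S : Set X) : Prop :=
  ∀ x : X, ∀ y ∈ Metric.ball x (Metric.infDist x S), ∀ z ∈ Metric.ball x (Metric.infDist x S),
    ∀ p ∈ closestPoints S y, ∀ q ∈ closestPoints S z, dist p q ≤ D

/-- A bi-infinite (continuous) `C`-quasi-geodesic. -/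
def IsQuasiGeodesicLine (C : ℝ) (γ : ℝ → X) : Prop :=
  1 ≤ C ∧ Continuous γ ∧
    ∀ s t : ℝ, |t - s| / C - C ≤ dist (γ s) (γ t) ∧ dist (γ s) (γ t) ≤ C * |t - s| + C

end Geodesics

section Gauge

/-- A contraction gauge `K : ℝ≥0 → ℝ≥0 ∪ {∞}`. -/
def IsContractionGauge (K : ℝ≥0 → ℝ≥0∞) : Prop :=
  Monotone K ∧ ∀ r : ℝ≥0, 4 * (r : ℝ≥0∞) + 1 ≤ K r

/-- A full contraction gauge: the value `∞` is not attained. -/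
def IsFullContractionGauge (K : ℝ≥0 → ℝ≥0∞) : Prop :=
  IsContractionGauge K ∧ ∀ r : ℝ≥0, K r ≠ ∞

/-- The gauge `K(r) = 10 r + 1`, whose contraction space is called the contraction space. -/
noncomputable def standardGauge (r : ℝ≥0) : ℝ≥0∞ := 10 * (r : ℝ≥0∞) + 1

theorem isFullContractionGauge_standardGauge : IsFullContractionGauge standardGauge := by
  refine ⟨⟨fun r s h => ?_, fun r => ?_⟩, fun r => ?_⟩
  · unfold standardGauge
    gcongr
  · unfold standardGauge
    gcongr
    norm_num
  · unfold standardGauge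
    exact ENNReal.add_ne_top.2 ⟨ENNReal.mul_ne_top (by norm_num) ENNReal.coe_ne_top, by norm_num⟩

end Gauge

section ContractionSpace

/-- The pair `(x, y)` is `K`-anti-contracting: `d(x, y) ≥ 1`, and no subsegment of length at least
`K r` of a geodesic from `x` to `y` is `r`-thin, for any `r ≥ 0`. -/
def IsAntiContracting {X : Type*} [MetricSpace X] (K : ℝ≥0 → ℝ≥0∞) (x y : X) : Prop :=
  1 ≤ dist x y ∧
    ∀ (r : ℝ≥0) (γ : ℝ → X), IsGeodesicFromTo γ x y →
      ∀ a b : ℝ, 0 ≤ a → a ≤ b → b ≤ dist x y →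
        K r ≤ ENNReal.ofReal (b - a) → ¬ IsThin (r : ℝ) γ a b

/-- The disjoint union of `X` and of one copy of the unit interval for every `K`-anti-contracting
pair `(x, y)`. -/
inductive PreContractionSpace (K : ℝ≥0 → ℝ≥0∞) (X : Type*) [MetricSpace X] where
  | point (x : X) : PreContractionSpace K X
  | edge (e : {e : X × X // IsAntiContracting K e.1 e.2}) (t : unitInterval) :
      PreContractionSpace K X

namespace PreContractionSpace

variable {K : ℝ≥0 → ℝ≥0∞} {X : Type*} [MetricSpace X]

/-- The gluing: the endpoints `0` and `1` of the interval of `(x, y)` are glued to `x` and `y`. -/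
inductive Glue : PreContractionSpace K X → PreContractionSpace K X → Prop
  | source (e : {e : X × X // IsAntiContracting K e.1 e.2}) : Glue (edge e 0) (point e.1.1)
  | target (e : {e : X × X // IsAntiContracting K e.1 e.2}) : Glue (edge e 1) (point e.1.2)

/-- `Walk a b ℓ`: one can get from `a` to `b` by finitely many moves inside `X`, moves inside one
of the added intervals, and passages between glued points, of total length `ℓ`. -/
inductive Walk : PreContractionSpace K X → PreContractionSpace K X → ℝ → Prop
  | nil (a : PreContractionSpace K X) : Walk a a 0
  | inSpace (x y : X) {b : PreContractionSpace K X} {l : ℝ} :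
      Walk (point y) b l → Walk (point x) b (dist x y + l)
  | inEdge (e : {e : X × X // IsAntiContracting K e.1 e.2}) (s t : unitInterval)
      {b : PreContractionSpace K X} {l : ℝ} :
      Walk (edge e t) b l → Walk (edge e s) b (dist s t + l)
  | glue {a a' b : PreContractionSpace K X} {l : ℝ} :
      Glue a a' → Walk a' b l → Walk a b l
  | unglue {a a' b : PreContractionSpace K X} {l : ℝ} :
      Glue a' a → Walk a' b l → Walk a b l

theorem Walk.nonneg {a b : PreContractionSpace K X} {l : ℝ} (h : Walk a b l) : 0 ≤ l := by
  induction h with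
  | nil a => exact le_rfl
  | inSpace x y _ ih => positivity
  | inEdge e s t _ ih => positivity
  | glue _ _ ih => exact ih
  | unglue _ _ ih => exact ih

theorem Walk.append {a b c : PreContractionSpace K X} {l m : ℝ} (h : Walk a b l)
    (h2 : Walk b c m) : Walk a c (l + m) := by
  induction h with
  | nil a => simpa using h2
  | inSpace x y _ ih => rw [add_assoc]; exact Walk.inSpace x y (ih h2)
  | inEdge e s t _ ih => rw [add_assoc]; exact Walk.inEdge e s t (ih h2)
  | glue g _ ih => exact Walk.glue g (ih h2)
  | unglue g _ ih => exact Walk.unglue g (ih h2)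

theorem Walk.reverse {a b : PreContractionSpace K X} {l : ℝ} (h : Walk a b l) : Walk b a l := by
  induction h with
  | nil a => exact Walk.nil a
  | inSpace x y _ ih =>
    have := ih.append (Walk.inSpace y x (Walk.nil _))
    rwa [add_zero, dist_comm, add_comm] at this
  | inEdge e s t _ ih =>
    have := ih.append (Walk.inEdge e t s (Walk.nil _))
    rwa [add_zero, dist_comm, add_comm] at this
  | glue g _ ih => simpa using ih.append (Walk.unglue g (Walk.nil _))
  | unglue g _ ih => simpa using ih.append (Walk.glue g (Walk.nil _))

theorem Walk.exists_to_point (a : PreContractionSpace K X) :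
    ∃ (x : X) (l : ℝ), Walk a (point x) l := by
  cases a with
  | point x => exact ⟨x, 0, Walk.nil _⟩
  | edge e t => exact ⟨e.1.1, _, Walk.inEdge e t 0 (Walk.glue (Glue.source e) (Walk.nil _))⟩

theorem Walk.exists (a b : PreContractionSpace K X) : ∃ l : ℝ, Walk a b l := by
  obtain ⟨x, l, hx⟩ := Walk.exists_to_point a
  obtain ⟨y, m, hy⟩ := Walk.exists_to_point b
  exact ⟨_, hx.append (Walk.inSpace x y hy.reverse)⟩

/-- The path pseudo-metric: the infimum of the lengths of all walks. -/
noncomputable instance instPseudoMetricSpace : PseudoMetricSpace (PreContractionSpace K X) where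
  dist a b := sInf {l : ℝ | Walk a b l}
  dist_self a := by
    apply le_antisymm
    · exact csInf_le ⟨0, fun l hl => hl.nonneg⟩ (Walk.nil a)
    · exact Real.sInf_nonneg fun l hl => hl.nonneg
  dist_comm a b := by
    congr 1
    ext l
    exact ⟨Walk.reverse, Walk.reverse⟩
  dist_triangle a b c := by
    refine le_of_forall_pos_le_add fun ε hε => ?_
    obtain ⟨l, hl, hl'⟩ := Real.lt_sInf_add_pos (s := {l : ℝ | Walk a b l})
      (Walk.exists a b) (half_pos hε)
    obtain ⟨m, hm, hm'⟩ := Real.lt_sInf_add_pos (s := {l : ℝ | Walk b c l})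
      (Walk.exists b c) (half_pos hε)
    have : sInf {l : ℝ | Walk a c l} ≤ l + m :=
      csInf_le ⟨0, fun l hl => hl.nonneg⟩ (Walk.append hl hm)
    linarith

end PreContractionSpace

/-- The `K`-contraction space of `X`: the space obtained from `X` by attaching an interval of
length one to every `K`-anti-contracting pair of points, with the induced path metric.
Points of the disjoint union at distance zero (that is, glued points) are identified. -/
abbrev ContractionSpace (K : ℝ≥0 → ℝ≥0∞) (X : Type*) [MetricSpace X] : Type _ :=
  SeparationQuotient (PreContractionSpace K X)

end ContractionSpace

section Action

variable {G : Type*} [Group G] {X : Type*} [MetricSpace X] [MulAction G X] [IsIsometricSMul G X]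

theorem IsGeodesicOn.smul (g : G) {γ : ℝ → X} {a b : ℝ} (h : IsGeodesicOn γ a b) :
    IsGeodesicOn (fun t => g • γ t) a b :=
  ⟨h.1, fun s hs t ht => by rw [dist_smul]; exact h.2 s hs t ht⟩

theorem IsGeodesicFromTo.smul (g : G) {γ : ℝ → X} {x y : X} (h : IsGeodesicFromTo γ x y) :
    IsGeodesicFromTo (fun t => g • γ t) (g • x) (g • y) := by
  refine ⟨?_, ?_, ?_⟩
  · rw [dist_smul]; exact h.1.smul g
  · simp only [h.2.1]
  · simp only [dist_smul, h.2.2]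

theorem IsThin.smul (g : G) {r : ℝ} {γ : ℝ → X} {a b : ℝ} (h : IsThin r γ a b) :
    IsThin r (fun t => g • γ t) a b := by
  intro γ₁ γ₂ γ₃ γ₄ c d z w hc hd h₁ he h₂ h₃ h₄
  have key : ∀ (δ : ℝ → X) (x y p : X),
      p ∈ geodesicImage (fun t => g⁻¹ • δ t) (g⁻¹ • x) (g⁻¹ • y) →
      g • p ∈ geodesicImage δ x y := by
    rintro δ x y p ⟨t, ht, rfl⟩
    rw [dist_smul] at ht
    exact ⟨t, ht, by simp⟩
  obtain ⟨p, hp, hpd⟩ := h (fun t => g⁻¹ • γ₁ t) (fun t => g⁻¹ • γ₂ t) (fun t => g⁻¹ • γ₃ t)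
    (fun t => g⁻¹ • γ₄ t) c d (g⁻¹ • z) (g⁻¹ • w) hc hd (h₁.smul g⁻¹)
    (fun t ht => by simp [he ht]) (h₂.smul g⁻¹) (h₃.smul g⁻¹) (h₄.smul g⁻¹)
  refine ⟨g • p, ?_, by rw [dist_smul]; exact hpd⟩
  rcases hp with (hp | hp) | hp
  · exact Or.inl (Or.inl (key _ _ _ _ hp))
  · exact Or.inl (Or.inr (key _ _ _ _ hp))
  · exact Or.inr (key _ _ _ _ hp)

theorem IsAntiContracting.smul (g : G) {K : ℝ≥0 → ℝ≥0∞} {x y : X} (h : IsAntiContracting K x y) :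
    IsAntiContracting K (g • x) (g • y) := by
  refine ⟨by rw [dist_smul]; exact h.1, fun r γ hγ a b ha hab hb hK ht => ?_⟩
  rw [dist_smul] at hb
  have hγ' := hγ.smul g⁻¹
  rw [inv_smul_smul, inv_smul_smul] at hγ'
  exact h.2 r _ hγ' a b ha hab hb hK (ht.smul g⁻¹)

namespace PreContractionSpace

variable {K : ℝ≥0 → ℝ≥0∞}

/-- The induced action: `g` maps the interval attached to `(x, y)` to the one attached to
`(g x, g y)`. -/
instance instMulAction : MulAction G (PreContractionSpace K X) where
  smul g a := match a with
    | point x => point (g • x)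
    | edge e t => edge ⟨(g • e.1.1, g • e.1.2), e.2.smul g⟩ t
  one_smul a := by
    cases a with
    | point x => exact congrArg point (one_smul G x)
    | edge e t =>
      refine congrArg (fun e => edge e t) (Subtype.ext ?_)
      exact Prod.ext (one_smul G e.1.1) (one_smul G e.1.2)
  mul_smul g h a := by
    cases a with
    | point x => exact congrArg point (mul_smul g h x)
    | edge e t =>
      refine congrArg (fun e => edge e t) (Subtype.ext ?_)
      exact Prod.ext (mul_smul g h e.1.1) (mul_smul g h e.1.2)

theorem Glue.smul (g : G) {a b : PreContractionSpace K X} (h : Glue a b) :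
    Glue (g • a) (g • b) := by
  cases h with
  | source e => exact Glue.source ⟨(g • e.1.1, g • e.1.2), e.2.smul g⟩
  | target e => exact Glue.target ⟨(g • e.1.1, g • e.1.2), e.2.smul g⟩

theorem Walk.smul (g : G) {a b : PreContractionSpace K X} {l : ℝ} (h : Walk a b l) :
    Walk (g • a) (g • b) l := by
  induction h with
  | nil a => exact Walk.nil _
  | inSpace x y _ ih =>
    rw [← dist_smul g x y]
    exact Walk.inSpace (g • x) (g • y) ih
  | inEdge e s t _ ih => exact Walk.inEdge ⟨(g • e.1.1, g • e.1.2), e.2.smul g⟩ s t ih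
  | glue h _ ih => exact Walk.glue (h.smul g) ih
  | unglue h _ ih => exact Walk.unglue (h.smul g) ih

instance instIsIsometricSMul : IsIsometricSMul G (PreContractionSpace K X) where
  isometry_smul g := by
    refine Isometry.of_dist_eq fun a b => ?_
    change sInf {l : ℝ | Walk (g • a) (g • b) l} = sInf {l : ℝ | Walk a b l}
    congr 1
    ext l
    exact ⟨fun h => by simpa using h.smul g⁻¹, fun h => h.smul g⟩

end PreContractionSpace

/-- A geometric action: metrically proper and cobounded (the action being isometric). -/
def IsGeometricAction (G : Type*) [Group G] (X : Type*) [MetricSpace X] [MulAction G X]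
    [IsIsometricSMul G X] : Prop :=
  (∀ (x : X) (R : ℝ), {g : G | dist x (g • x) ≤ R}.Finite) ∧
    ∃ (x : X) (R : ℝ), ∀ y : X, ∃ g : G, dist y (g • x) ≤ R

/-- `g` is loxodromic for the action on `Y`: for some point `y`, the orbit map `n ↦ gⁿ y` is a
quasi-isometric embedding of `ℤ`. -/
def IsLoxodromic {G : Type*} [Group G] (Y : Type*) [MetricSpace Y] [MulAction G Y] (g : G) :
    Prop :=
  ∃ (y : Y) (C : ℝ), 1 ≤ C ∧ ∀ m n : ℤ,
    |(m : ℝ) - n| / C - C ≤ dist (g ^ m • y) (g ^ n • y) ∧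
      dist (g ^ m • y) (g ^ n • y) ≤ C * |(m : ℝ) - n| + C

/-- `g` is a WPD element for the action on `Y`. -/
def IsWPD {G : Type*} [Group G] (Y : Type*) [MetricSpace Y] [MulAction G Y] (g : G) : Prop :=
  IsLoxodromic Y g ∧ ∀ (y : Y) (R : ℝ), 0 < R → ∃ N : ℕ,
    {h : G | dist y (h • y) < R ∧ dist (g ^ N • y) (h • g ^ N • y) < R}.Finite

/-- `g` is strongly contracting for the action on `X`: it is loxodromic and, for some `C`,
stabilises a bi-infinite `C`-contracting `C`-quasi-geodesic. -/
def IsStronglyContracting {G : Type*} [Group G] (X : Type*) [MetricSpace X] [MulAction G X]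
    (g : G) : Prop :=
  IsLoxodromic X g ∧ ∃ (C : ℝ) (γ : ℝ → X), IsQuasiGeodesicLine C γ ∧
    IsContracting C (Set.range γ) ∧ (fun x => g • x) '' Set.range γ = Set.range γ

end Action

/-! ### Geodesic segments as sets, and the transfer of thinness. -/

section GeodesicSegments

variable {X : Type*} [MetricSpace X]

/-! The implications run 1 → 3 → 2 → 1, the last being part of the definition of WPD.

From loxodromic to contracting. Distances in the contraction space are compared with
`contractionDist`, the path metric of a graph on `X` whose edges are the pairs at distance at most
one and the anti-contracting pairs. Geodesic triangles of `X` are 1-thin for it: if `m` lies on a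
side and `p` is a closest point of the other two sides, a thin piece of a geodesic from `m` to `p`
would force both halves of the side through `m` to come near its midpoint, which `K r ≥ 4r + 1`
rules out (`IsSegment.isAntiContracting_of_closest`). The usual logarithmic estimate then gives a
Morse lemma: geodesics of `X` between orbit points stay contraction-close to the orbit
(`IsCoarseLine.exists_close`). As the contraction distance grows linearly along the orbit, such
geodesics cannot be cut into pieces of a large fixed length that each have contraction length at
most one, so they carry thin points (`IsCoarseLine.exists_isThinPoint`), and powers of `g` spread
thin points all along the orbit (`exists_isThinAxis`). A geodesic between points with distant
projections must pass near the thin points well in between, and contraction follows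
(`isContracting_orbitLine`).

From contracting to WPD. The projection to the axis, read as a real parameter and made Lipschitz, is
a function `ψ` such that a geodesic along which `ψ` crosses the value `s` passes near the point of
parameter `s` (`IsTracking.exists_dist_le`). Hence geodesics along which `ψ` varies a lot contain
long thin pieces at a scale `r` depending only on the axis. Because `K r` is finite, `ψ` varies
boundedly over anti-contracting pairs (`IsTracking.exists_abs_sub_le`), and so extends to a
Lipschitz function on the contraction space; this makes `g` loxodromic there. If `h` moves two
distant orbit points little, it sends a geodesic between them to one that still crosses the middle
value of `ψ`, hence passes near a point of `X` independent of `h`; properness of the action on `X`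
leaves finitely many `h`. -/

theorem IsGeodesicOn.mono {γ : ℝ → X} {a b c d : ℝ} (h : IsGeodesicOn γ a b) (hac : a ≤ c)
    (hcd : c ≤ d) (hdb : d ≤ b) : IsGeodesicOn γ c d :=
  ⟨hcd, fun s hs t ht => h.2 s ⟨hac.trans hs.1, hs.2.trans hdb⟩ t ⟨hac.trans ht.1, ht.2.trans hdb⟩⟩

theorem IsGeodesicOn.dist_eq {γ : ℝ → X} {a b s t : ℝ} (h : IsGeodesicOn γ a b) (has : a ≤ s)
    (hst : s ≤ t) (htb : t ≤ b) : dist (γ s) (γ t) = t - s := by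
  rw [h.2 s ⟨has, hst.trans htb⟩ t ⟨has.trans hst, htb⟩, abs_sub_comm, abs_of_nonneg (by linarith)]

/-- Reparametrisation of a geodesic segment by a translation. -/
theorem IsGeodesicOn.translate {γ : ℝ → X} {a b : ℝ} (h : IsGeodesicOn γ a b) (s : ℝ) :
    IsGeodesicOn (fun t => γ (t + s)) (a - s) (b - s) :=
  ⟨by linarith [h.1], fun u hu v hv => by
    rw [h.2 (u + s) ⟨by linarith [hu.1], by linarith [hu.2]⟩ (v + s)
      ⟨by linarith [hv.1], by linarith [hv.2]⟩]
    congr 1; ring⟩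

theorem IsGeodesicOn.continuousOn {γ : ℝ → X} {a b : ℝ} (h : IsGeodesicOn γ a b) :
    ContinuousOn γ (Set.Icc a b) := by
  have : LipschitzOnWith 1 γ (Set.Icc a b) :=
    LipschitzOnWith.of_dist_le_mul fun s hs t ht => by
      rw [h.2 s hs t ht, Real.dist_eq]; simp
  exact this.continuousOn

/-- `A` is the image of a geodesic from `x` to `y`. -/
def IsSegment (A : Set X) (x y : X) : Prop :=
  ∃ γ : ℝ → X, IsGeodesicFromTo γ x y ∧ A = geodesicImage γ x y

theorem IsGeodesicOn.isGeodesicFromTo {γ : ℝ → X} {a b : ℝ} (h : IsGeodesicOn γ a b) :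
    IsGeodesicFromTo (fun t => γ (t + a)) (γ a) (γ b) := by
  have hd := h.dist_eq le_rfl h.1 le_rfl
  have := h.translate a
  rw [sub_self] at this
  refine ⟨?_, by simp, ?_⟩
  · rwa [hd]
  · simp [hd]

theorem IsGeodesicOn.isSegment {γ : ℝ → X} {a b : ℝ} (h : IsGeodesicOn γ a b) :
    IsSegment (γ '' Set.Icc a b) (γ a) (γ b) := by
  refine ⟨_, h.isGeodesicFromTo, ?_⟩
  have hd := h.dist_eq le_rfl h.1 le_rfl
  rw [geodesicImage, hd]
  ext p
  constructor
  · rintro ⟨t, ht, rfl⟩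
    exact ⟨t - a, ⟨by linarith [ht.1], by linarith [ht.2]⟩, by simp⟩
  · rintro ⟨t, ht, rfl⟩
    exact ⟨t + a, ⟨by linarith [ht.1], by linarith [ht.2]⟩, rfl⟩

theorem IsGeodesicFromTo.isSegment {γ : ℝ → X} {x y : X} (h : IsGeodesicFromTo γ x y) :
    IsSegment (geodesicImage γ x y) x y := ⟨γ, h, rfl⟩

theorem IsSegment.symm {A : Set X} {x y : X} (h : IsSegment A x y) : IsSegment A y x := by
  obtain ⟨γ, ⟨hγ, h0, h1⟩, rfl⟩ := h
  refine ⟨fun t => γ (dist x y - t), ⟨⟨dist_nonneg, fun s hs t ht => ?_⟩, by simpa using h1, ?_⟩, ?_⟩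
  · rw [dist_comm y x] at hs ht
    rw [hγ.2 _ ⟨by linarith [hs.2], by linarith [hs.1]⟩ _
      ⟨by linarith [ht.2], by linarith [ht.1]⟩, abs_sub_comm]
    congr 1; ring
  · simpa [dist_comm y x] using h0
  · ext p
    simp only [geodesicImage, dist_comm y x]
    constructor
    · rintro ⟨t, ht, rfl⟩
      exact ⟨dist x y - t, ⟨by linarith [ht.2], by linarith [ht.1]⟩, by simp⟩
    · rintro ⟨t, ht, rfl⟩
      exact ⟨dist x y - t, ⟨by linarith [ht.2], by linarith [ht.1]⟩, rfl⟩

theorem isSegment_singleton (x : X) : IsSegment {x} x x :=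
  ⟨fun _ => x, ⟨⟨by simp, fun s hs t ht => by
    rw [dist_self] at hs ht
    rw [le_antisymm hs.2 hs.1, le_antisymm ht.2 ht.1]; simp⟩, rfl, rfl⟩, by simp [geodesicImage]⟩

theorem IsSegment.left_mem {A : Set X} {x y : X} (h : IsSegment A x y) : x ∈ A := by
  obtain ⟨γ, ⟨_, h0, _⟩, rfl⟩ := h
  exact ⟨0, ⟨le_rfl, dist_nonneg⟩, h0⟩

theorem IsSegment.right_mem {A : Set X} {x y : X} (h : IsSegment A x y) : y ∈ A := h.symm.left_mem

theorem IsSegment.isCompact {A : Set X} {x y : X} (h : IsSegment A x y) : IsCompact A := by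
  obtain ⟨γ, ⟨hγ, _, _⟩, rfl⟩ := h
  exact isCompact_Icc.image_of_continuousOn hγ.continuousOn

theorem IsSegment.dist_add_dist {A : Set X} {x y m : X} (h : IsSegment A x y) (hm : m ∈ A) :
    dist x m + dist m y = dist x y := by
  obtain ⟨γ, ⟨hγ, h0, h1⟩, rfl⟩ := h
  obtain ⟨t, ht, rfl⟩ := hm
  have e1 := hγ.dist_eq le_rfl ht.1 ht.2
  have e2 := hγ.dist_eq ht.1 ht.2 le_rfl
  rw [h0] at e1
  rw [h1] at e2
  linarith

theorem IsSegment.exists_split {A : Set X} {x y m : X} (h : IsSegment A x y) (hm : m ∈ A) :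
    ∃ A₁ A₂, IsSegment A₁ x m ∧ IsSegment A₂ m y ∧ A₁ ∪ A₂ = A := by
  obtain ⟨γ, ⟨hγ, h0, h1⟩, rfl⟩ := h
  obtain ⟨t, ht, rfl⟩ := hm
  have s1 := (hγ.mono le_rfl ht.1 ht.2).isSegment
  have s2 := (hγ.mono ht.1 ht.2 le_rfl).isSegment
  rw [h0] at s1
  rw [h1] at s2
  exact ⟨_, _, s1, s2, by rw [← Set.image_union, Set.Icc_union_Icc_eq_Icc ht.1 ht.2]; rfl⟩

/-- Of two points of a segment, one lies on the subsegment from the origin to the other. -/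
theorem IsSegment.exists_subsegment {A : Set X} {x y u v : X} (h : IsSegment A x y) (hu : u ∈ A)
    (hv : v ∈ A) :
    (∃ B, IsSegment B x v ∧ u ∈ B) ∨ (∃ B, IsSegment B x u ∧ v ∈ B) := by
  obtain ⟨A₁, A₂, h₁, h₂, rfl⟩ := h.exists_split hu
  rcases hv with hv | hv
  · exact Or.inr ⟨A₁, h₁, hv⟩
  · left
    obtain ⟨γ, ⟨hγ, h0, h1⟩, e⟩ := h
    obtain ⟨s, hs, rfl⟩ : u ∈ geodesicImage γ x y := e ▸ hu
    obtain ⟨t, ht, rfl⟩ : v ∈ geodesicImage γ x y := e ▸ Set.mem_union_right _ hv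
    have hst : s ≤ t := by
      have := h₂.dist_add_dist hv
      by_contra hlt
      push Not at hlt
      have e1 := hγ.dist_eq ht.1 hlt.le hs.2
      have e2 := hγ.dist_eq ht.1 ht.2 le_rfl
      have e3 := hγ.dist_eq hs.1 hs.2 le_rfl
      rw [h1] at e2 e3
      have := dist_nonneg (x := γ s) (y := γ t)
      linarith
    have := (hγ.mono le_rfl ht.1 ht.2).isSegment
    rw [h0] at this
    exact ⟨_, this, s, ⟨hs.1, hst⟩, rfl⟩

theorem IsSegment.smul {G : Type*} [Group G] [MulAction G X] [IsIsometricSMul G X] (g : G)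
    {A : Set X} {x y : X} (h : IsSegment A x y) :
    IsSegment ((fun p => g • p) '' A) (g • x) (g • y) := by
  obtain ⟨γ, hγ, rfl⟩ := h
  exact ⟨_, hγ.smul g, by rw [geodesicImage, geodesicImage, dist_smul, Set.image_image]⟩

theorem IsGeodesicSpace.exists_isSegment (hX : IsGeodesicSpace X) (x y : X) :
    ∃ A, IsSegment A x y := by
  obtain ⟨γ, hγ⟩ := hX x y
  exact ⟨_, hγ.isSegment⟩

/-- Concatenation of two geodesics. -/
theorem IsGeodesicFromTo.exists_concat {α β : ℝ → X} {x y z : X} (hα : IsGeodesicFromTo α x y)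
    (hβ : IsGeodesicFromTo β y z) (hd : dist x y + dist y z = dist x z) :
    ∃ γ : ℝ → X, IsGeodesicFromTo γ x z ∧ (∀ t ∈ Set.Icc 0 (dist x y), γ t = α t) ∧
      ∀ t ∈ Set.Icc 0 (dist y z), γ (t + dist x y) = β t := by
  obtain ⟨hα, a0, a1⟩ := hα
  obtain ⟨hβ, b0, b1⟩ := hβ
  have e1 : ∀ t ∈ Set.Icc 0 (dist x y), (if t ≤ dist x y then α t else β (t - dist x y)) = α t :=
    fun t ht => if_pos ht.2
  have e2 : ∀ t ∈ Set.Icc 0 (dist y z),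
      (if t + dist x y ≤ dist x y then α (t + dist x y) else β (t + dist x y - dist x y)) = β t := by
    intro t ht
    split_ifs with h
    · have : t = 0 := by linarith [ht.1]
      subst this
      rw [zero_add, a1, b0]
    · congr 1; ring
  have key : ∀ s ∈ Set.Icc 0 (dist x y), ∀ t ∈ Set.Icc 0 (dist y z),
      dist (α s) (β t) = t + dist x y - s := by
    intro s hs t ht
    have h1 := hα.dist_eq hs.1 hs.2 le_rfl
    have h2 := hβ.dist_eq le_rfl ht.1 ht.2
    have h3 := hα.dist_eq le_rfl hs.1 hs.2
    have h4 := hβ.dist_eq ht.1 ht.2 le_rfl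
    rw [a1] at h1
    rw [b0] at h2
    rw [a0] at h3
    rw [b1] at h4
    have t1 := dist_triangle (α s) y (β t)
    have t2 := dist_triangle4 x (α s) (β t) z
    linarith
  refine ⟨fun t => if t ≤ dist x y then α t else β (t - dist x y), ⟨⟨dist_nonneg, ?_⟩, ?_, ?_⟩,
    e1, e2⟩
  · have main : ∀ s ∈ Set.Icc 0 (dist x z), ∀ t ∈ Set.Icc 0 (dist x z), s ≤ t →
        dist (if s ≤ dist x y then α s else β (s - dist x y))
          (if t ≤ dist x y then α t else β (t - dist x y)) = |s - t| := by
      intro s hs t ht hst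
      rw [abs_sub_comm, abs_of_nonneg (by linarith)]
      split_ifs with h1 h2 h2
      · exact hα.dist_eq hs.1 hst h2
      · rw [key s ⟨hs.1, h1⟩ _ ⟨by linarith, by linarith [ht.2]⟩]; ring
      · exact absurd (hst.trans h2) h1
      · rw [hβ.dist_eq (by linarith) (by linarith) (by linarith [ht.2])]; ring
    intro s hs t ht
    rcases le_total s t with h | h
    · exact main s hs t ht h
    · rw [dist_comm, abs_sub_comm]; exact main t ht s hs h
  · simp [a0]
  · have := e2 (dist y z) ⟨dist_nonneg, le_rfl⟩
    rw [add_comm, hd, b1] at this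
    exact this

/-- Thinness depends only on the segment and not on the geodesic containing it, so it survives
splicing the segment into a longer geodesic. -/
theorem IsThin.translate {r : ℝ} {γ γ' : ℝ → X} {a b s : ℝ} (h : IsThin r γ a b) (hab : a ≤ b)
    (hγ : ∀ t ∈ Set.Icc a b, γ' (t + s) = γ t) : IsThin r γ' (a + s) (b + s) := by
  intro γ₁ γ₂ γ₃ γ₄ c d z w hc hd h₁ he h₂ h₃ h₄
  obtain ⟨p, hp, hpd⟩ := h (fun t => γ₁ (t + s)) γ₂ γ₃ γ₄ (c - s) (d - s) z w (by linarith)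
    (by linarith) (h₁.translate s)
    (fun t ht => by
      have : γ₁ (t + s) = γ' (t + s) := he ⟨by linarith [ht.1], by linarith [ht.2]⟩
      simp only [this, hγ t ht]) (by simpa using h₂) h₃ (by simpa using h₄)
  refine ⟨p, by simpa using hp, ?_⟩
  have : (a + s + (b + s)) / 2 = (a + b) / 2 + s := by ring
  rw [this, hγ _ ⟨by linarith, by linarith⟩]
  exact hpd

theorem IsThin.exists_dist_le {r : ℝ} {γ : ℝ → X} {a b : ℝ} (h : IsThin r γ a b) {x y z w : X}
    {A B C : Set X} (hγ : IsGeodesicFromTo γ x y) (ha : 0 ≤ a) (hb : b ≤ dist x y)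
    (hA : IsSegment A y z) (hB : IsSegment B z w) (hC : IsSegment C w x) :
    ∃ p ∈ A ∪ B ∪ C, dist p (γ ((a + b) / 2)) ≤ r := by
  obtain ⟨α, hα, rfl⟩ := hA
  obtain ⟨β, hβ, rfl⟩ := hB
  obtain ⟨δ, hδ, rfl⟩ := hC
  obtain ⟨hγ, h0, h1⟩ := hγ
  have := h γ α β δ 0 (dist x y) z w ha hb hγ (fun _ _ => rfl) (by rwa [h1]) hβ (by rwa [h0])
  rwa [h0, h1] at this

end GeodesicSegments

/-! ### The contraction graph and its thin triangles. -/

section ContractionGraph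

variable {X : Type*} [MetricSpace X] {K : ℝ≥0 → ℝ≥0∞}

theorem IsContractionGauge.le_of_le (hK : IsContractionGauge K) {r : ℝ≥0} {l : ℝ}
    (h : K r ≤ ENNReal.ofReal l) : 4 * (r : ℝ) + 1 ≤ l := by
  have h1 := (hK.2 r).trans h
  have e : (4 * (r : ℝ≥0∞) + 1) = ENNReal.ofReal (4 * (r : ℝ) + 1) := by
    rw [ENNReal.ofReal_add (by positivity) (by norm_num), ENNReal.ofReal_mul (by norm_num)]
    simp
  rw [e] at h1
  have hpos : 0 < l := by
    by_contra hl
    rw [ENNReal.ofReal_of_nonpos (not_lt.1 hl), nonpos_iff_eq_zero, ENNReal.ofReal_eq_zero] at h1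
    have := r.coe_nonneg
    linarith
  exact (ENNReal.ofReal_le_ofReal_iff hpos.le).1 h1

/-- A point of a side of a geodesic triangle and a closest point of the other two sides form an
anti-contracting pair as soon as their distance is at least one. -/
theorem IsSegment.isAntiContracting_of_closest (hK : IsContractionGauge K) {x y z m p : X}
    {A B C : Set X} (hA : IsSegment A x y) (hB : IsSegment B y z) (hC : IsSegment C z x)
    (hm : m ∈ A) (hp : p ∈ C) (hmin : ∀ q ∈ B ∪ C, dist m p ≤ dist m q) (h1 : 1 ≤ dist m p) :
    IsAntiContracting K m p := by
  refine ⟨h1, fun r γ hγ a b ha hab hb hr hthin => ?_⟩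
  have hr := hK.le_of_le hr
  obtain ⟨A₁, A₂, hA₁, hA₂, rfl⟩ := hA.exists_split hm
  obtain ⟨C₁, C₂, hC₁, hC₂, rfl⟩ := hC.exists_split hp
  have e1 := hγ.1.dist_eq le_rfl (by linarith : (0 : ℝ) ≤ (a + b) / 2) (by linarith)
  have e2 := hγ.1.dist_eq (by linarith : (0 : ℝ) ≤ (a + b) / 2) (by linarith) le_rfl
  rw [hγ.2.1] at e1
  rw [hγ.2.2] at e2
  -- By minimality a point of `B ∪ C` within `r` of the midpoint would put `p` within `r` of it, but
  -- `p` is at distance at least `(b - a) / 2 ≥ 2r + 1/2`.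
  have far : ∀ q ∈ B ∪ (C₁ ∪ C₂), ¬ dist q (γ ((a + b) / 2)) ≤ r := by
    intro q hq hle
    have := hmin q hq
    have := dist_triangle m (γ ((a + b) / 2)) q
    rw [dist_comm (γ _) q] at this
    linarith [r.coe_nonneg]
  -- Two quadrangles on the geodesic from `m` to `p`: one closes up through `x`, the other through
  -- `z` and `y`. As `B ∪ C` is excluded, each half of `A` comes within `r` of the midpoint.
  obtain ⟨w, hw, hwd⟩ := hthin.exists_dist_le hγ ha hb hC₂ hA₁ (isSegment_singleton m)
  obtain ⟨w', hw', hwd'⟩ := hthin.exists_dist_le hγ ha hb hC₁.symm hB.symm hA₂.symm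
  have hwA : w ∈ A₁ := by
    rcases hw with (hw | hw) | hw
    · exact absurd hwd (far w (Or.inr (Or.inr hw)))
    · exact hw
    · rw [Set.mem_singleton_iff.1 hw]; exact hA₁.right_mem
  have hwA' : w' ∈ A₂ := by
    rcases hw' with (hw' | hw') | hw'
    · exact absurd hwd' (far w' (Or.inr (Or.inl hw')))
    · exact absurd hwd' (far w' (Or.inl hw'))
    · exact hw'
  -- `w` and `w'` lie on either side of `m` on a geodesic, each at distance at least `r + 1/2` from
  -- `m`, so they are at least `2r + 1` apart; but both are within `r` of the midpoint.
  have d1 := hA₁.dist_add_dist hwA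
  have d2 := hA₂.dist_add_dist hwA'
  have d3 := hA.dist_add_dist hm
  have d4 := dist_triangle4 x w w' y
  have d5 := dist_triangle w (γ ((a + b) / 2)) w'
  have d6 := dist_triangle m w (γ ((a + b) / 2))
  have d7 := dist_triangle m w' (γ ((a + b) / 2))
  rw [dist_comm (γ _) w'] at d5
  rw [dist_comm m w] at d6
  have := r.coe_nonneg
  linarith

variable (K) in
/-- Two points are adjacent if they are at distance at most one or form an anti-contracting
pair. -/
def contractionGraph (X : Type*) [MetricSpace X] : SimpleGraph X :=
  SimpleGraph.fromRel fun x y => dist x y ≤ 1 ∨ IsAntiContracting K x y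

variable (K) in
/-- The path metric of the contraction graph. -/
noncomputable def contractionDist (x y : X) : ℕ := (contractionGraph K X).dist x y

theorem contractionGraph_adj {x y : X} : (contractionGraph K X).Adj x y ↔
    x ≠ y ∧ (dist x y ≤ 1 ∨ IsAntiContracting K x y ∨ IsAntiContracting K y x) := by
  rw [contractionGraph, SimpleGraph.fromRel_adj, dist_comm y x]
  tauto

theorem contractionDist_le_one_of_dist_le {x y : X} (h : dist x y ≤ 1) :
    contractionDist K x y ≤ 1 := by
  by_cases e : x = y
  · subst e; simp [contractionDist]
  · exact (SimpleGraph.dist_eq_one_iff_adj.2 (contractionGraph_adj.2 ⟨e, Or.inl h⟩)).le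

theorem IsAntiContracting.contractionDist_le_one {x y : X} (h : IsAntiContracting K x y) :
    contractionDist K x y ≤ 1 := by
  by_cases e : x = y
  · subst e; simp [contractionDist]
  · exact (SimpleGraph.dist_eq_one_iff_adj.2 (contractionGraph_adj.2 ⟨e, Or.inr (Or.inl h)⟩)).le

theorem contractionDist_comm (x y : X) : contractionDist K x y = contractionDist K y x :=
  SimpleGraph.dist_comm

@[simp] theorem contractionDist_self (x : X) : contractionDist K x x = 0 := by
  simp [contractionDist]

theorem contractionDist_smul {G : Type*} [Group G] [MulAction G X] [IsIsometricSMul G X] (g : G)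
    (x y : X) : contractionDist K (g • x) (g • y) = contractionDist K x y := by
  have adj : ∀ (h : G) {u v : X}, (contractionGraph K X).Adj u v →
      (contractionGraph K X).Adj (h • u) (h • v) := by
    intro h u v huv
    rw [contractionGraph_adj] at huv ⊢
    refine ⟨fun e => huv.1 (smul_left_cancel h e), ?_⟩
    rw [dist_smul]
    rcases huv.2 with h1 | h1 | h1
    · exact Or.inl h1
    · exact Or.inr (Or.inl (h1.smul h))
    · exact Or.inr (Or.inr (h1.smul h))
  have key : ∀ (h : G) {u v : X} (p : (contractionGraph K X).Walk u v),
      ∃ q : (contractionGraph K X).Walk (h • u) (h • v), q.length = p.length := by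
    intro h u v p
    induction p with
    | nil => exact ⟨SimpleGraph.Walk.nil, rfl⟩
    | cons hadj _ ih =>
      obtain ⟨q, hq⟩ := ih
      exact ⟨SimpleGraph.Walk.cons (adj h hadj) q, by simp [hq]⟩
  rw [contractionDist, contractionDist, SimpleGraph.dist_eq_sInf, SimpleGraph.dist_eq_sInf]
  congr 1
  ext n
  constructor
  · rintro ⟨p, rfl⟩
    obtain ⟨q, hq⟩ := key g⁻¹ p
    exact ⟨q.copy (by simp) (by simp), by simpa using hq⟩
  · rintro ⟨p, rfl⟩
    exact key g p

theorem IsGeodesicOn.reachable {γ : ℝ → X} {a b : ℝ} (h : IsGeodesicOn γ a b) (n : ℕ)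
    (hn : b - a ≤ n) : ∃ p : (contractionGraph K X).Walk (γ a) (γ b), p.length ≤ n := by
  induction n generalizing b with
  | zero =>
    have : b = a := le_antisymm (by simpa using hn) h.1
    subst this
    exact ⟨SimpleGraph.Walk.nil, by simp⟩
  | succ n ih =>
    push_cast at hn
    by_cases hb : b - a ≤ n
    · obtain ⟨p, hp⟩ := ih h hb
      exact ⟨p, by omega⟩
    · push Not at hb
      have h0 : (0 : ℝ) ≤ n := Nat.cast_nonneg n
      obtain ⟨p, hp⟩ := ih (b := a + n) (h.mono le_rfl (by linarith) (by linarith)) (by linarith)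
      have hd : dist (γ (a + n)) (γ b) ≤ 1 := by
        rw [h.dist_eq (by linarith) (by linarith) le_rfl]; linarith
      by_cases e : γ (a + n) = γ b
      · exact ⟨p.copy rfl e, by simp; omega⟩
      · exact ⟨p.concat (contractionGraph_adj.2 ⟨e, Or.inl hd⟩), by simpa using hp⟩

theorem IsGeodesicSpace.contractionDist_le (hX : IsGeodesicSpace X) {x y : X} {n : ℕ}
    (h : dist x y ≤ n) : contractionDist K x y ≤ n := by
  obtain ⟨γ, hγ, h0, h1⟩ := hX x y
  obtain ⟨p, hp⟩ := hγ.reachable (K := K) n (by simpa using h)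
  exact (SimpleGraph.dist_le (p.copy h0 h1)).trans (by simpa using hp)

theorem IsGeodesicSpace.connected (hX : IsGeodesicSpace X) [Nonempty X] :
    (contractionGraph K X).Connected := by
  refine ⟨fun x y => ?_⟩
  obtain ⟨γ, hγ, h0, h1⟩ := hX x y
  obtain ⟨p, -⟩ := hγ.reachable (K := K) ⌈dist x y⌉₊ (by simpa using Nat.le_ceil _)
  rw [h0, h1] at p
  exact ⟨p⟩

theorem IsGeodesicSpace.contractionDist_triangle (hX : IsGeodesicSpace X) (x y z : X) :
    contractionDist K x z ≤ contractionDist K x y + contractionDist K y z :=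
  haveI : Nonempty X := ⟨x⟩
  hX.connected.dist_triangle

/-- Geodesic triangles of `X` are thin for the contraction distance. -/
theorem IsSegment.exists_contractionDist_le_one (hK : IsContractionGauge K) {x y z m : X}
    {A B C : Set X} (hA : IsSegment A x y) (hB : IsSegment B y z) (hC : IsSegment C z x)
    (hm : m ∈ A) : ∃ p ∈ B ∪ C, contractionDist K m p ≤ 1 := by
  obtain ⟨p, hp, hmin⟩ := (hB.isCompact.union hC.isCompact).exists_isMinOn
    ⟨y, Or.inl hB.left_mem⟩ (f := fun q => dist m q) (by fun_prop)
  have hmin : ∀ q ∈ B ∪ C, dist m p ≤ dist m q := fun q hq => hmin hq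
  refine ⟨p, hp, ?_⟩
  rcases le_total (dist m p) 1 with h1 | h1
  · exact contractionDist_le_one_of_dist_le h1
  refine IsAntiContracting.contractionDist_le_one ?_
  rcases hp with hp | hp
  · exact hA.symm.isAntiContracting_of_closest hK hC.symm hB.symm hm hp
      (fun q hq => hmin q (by rwa [Set.union_comm] at hq)) h1
  · exact hA.isAntiContracting_of_closest hK hB hC hm hp hmin h1

/-- Any geodesic from `x` to `m` extends to one from `x` to `y`, so its thin pieces would be thin
pieces for `(x, y)`: anti-contraction passes to initial segments of length at least one. This is the
base case of the dyadic argument below. -/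
theorem IsAntiContracting.contractionDist_le_one_of_mem {x y m : X} {A : Set X}
    (h : IsAntiContracting K x y) (hA : IsSegment A x y) (hm : m ∈ A) :
    contractionDist K x m ≤ 1 := by
  rcases le_total (dist x m) 1 with h1 | h1
  · exact contractionDist_le_one_of_dist_le h1
  refine IsAntiContracting.contractionDist_le_one ⟨h1, fun r γ hγ a b ha hab hb hr hthin => ?_⟩
  obtain ⟨A₁, A₂, -, ⟨β, hβ, -⟩, -⟩ := hA.exists_split hm
  have hd := hA.dist_add_dist hm
  obtain ⟨δ, hδ, e1, -⟩ := hγ.exists_concat hβ hd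
  refine h.2 r δ hδ a b ha hab (by linarith [dist_nonneg (x := m) (y := y)]) hr ?_
  have := hthin.translate (γ' := δ) (s := 0) hab
    (fun t ht => by rw [add_zero]; exact e1 t ⟨ha.trans ht.1, ht.2.trans hb⟩)
  simpa using this

/-- A geodesic of `X` stays logarithmically close to any path of the contraction graph with the
same endpoints. -/
theorem IsGeodesicSpace.exists_mem_support (hX : IsGeodesicSpace X) (hK : IsContractionGauge K)
    (k : ℕ) {x y m : X} (p : (contractionGraph K X).Walk x y) (hp : p.length ≤ 2 ^ k)
    {A : Set X} (hA : IsSegment A x y) (hm : m ∈ A) :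
    ∃ v ∈ p.support, contractionDist K m v ≤ k + 1 := by
  induction k generalizing x y m A with
  | zero =>
    cases p with
    | nil =>
      have := hA.dist_add_dist hm
      have : dist m x ≤ 1 := by
        rw [dist_self] at this
        linarith [dist_nonneg (x := m) (y := x), dist_nonneg (x := x) (y := m)]
      exact ⟨x, by simp, contractionDist_le_one_of_dist_le this⟩
    | cons hadj q =>
      cases q with
      | cons _ q' => simp at hp
      | nil =>
        rcases (contractionGraph_adj.1 hadj).2 with h | h | h
        · refine ⟨x, by simp, contractionDist_le_one_of_dist_le ?_⟩
          have := hA.dist_add_dist hm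
          rw [dist_comm]
          linarith [dist_nonneg (x := m) (y := y)]
        · exact ⟨x, by simp, by
            rw [contractionDist_comm]; exact h.contractionDist_le_one_of_mem hA hm⟩
        · exact ⟨y, by simp, by
            rw [contractionDist_comm]; exact h.contractionDist_le_one_of_mem hA.symm hm⟩
  | succ k ih =>
    -- Cutting the path at vertex `2 ^ k` costs one unit, by the thin triangle on that vertex. If
    -- the path is shorter, `getVert` returns `y`, which is harmless.
    obtain ⟨B, hB⟩ := hX.exists_isSegment x (p.getVert (2 ^ k))
    obtain ⟨C, hC⟩ := hX.exists_isSegment (p.getVert (2 ^ k)) y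
    obtain ⟨q, hq, hmq⟩ := hA.exists_contractionDist_le_one hK hC.symm hB.symm hm
    have tri := fun v => hX.contractionDist_triangle (K := K) m q v
    rcases hq with hq | hq
    · obtain ⟨v, hv, hqv⟩ := ih (p.drop (2 ^ k)) (by
        rw [SimpleGraph.Walk.drop_length]; rw [pow_succ] at hp; omega) hC hq
      exact ⟨v, (p.isSubwalk_drop _).support_subset hv, by have := tri v; omega⟩
    · obtain ⟨v, hv, hqv⟩ := ih (p.take (2 ^ k)) (by
        rw [SimpleGraph.Walk.take_length]; exact min_le_left _ _) hB hq
      exact ⟨v, (p.isSubwalk_take _).support_subset hv, by have := tri v; omega⟩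

end ContractionGraph

/-! ### The Morse lemma for the contraction distance. -/

section Stability

variable {X : Type*} [MetricSpace X] {K : ℝ≥0 → ℝ≥0∞}

theorem IsGeodesicSpace.exists_isSegment_mem (hX : IsGeodesicSpace X) {u m v : X}
    (h : dist u m + dist m v = dist u v) : ∃ A, IsSegment A u v ∧ m ∈ A := by
  obtain ⟨α, hα⟩ := hX u m
  obtain ⟨β, hβ⟩ := hX m v
  obtain ⟨γ, hγ, e, -⟩ := hα.exists_concat hβ h
  refine ⟨_, hγ.isSegment, dist u m, ⟨dist_nonneg, by rw [← h]; simp⟩, ?_⟩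
  rw [e _ ⟨dist_nonneg, le_rfl⟩, hα.2.2]

theorem contractionDist_le_length {u v w : X} (p : (contractionGraph K X).Walk u v)
    (hw : w ∈ p.support) : contractionDist K u w ≤ p.length := by
  classical
  exact (SimpleGraph.dist_le (p.takeUntil w hw)).trans (p.length_takeUntil_le_length hw)

theorem IsGeodesicSpace.exists_walk (hX : IsGeodesicSpace X) (u v : X) :
    ∃ p : (contractionGraph K X).Walk u v, p.length = contractionDist K u v :=
  haveI : Nonempty X := ⟨u⟩
  hX.connected.exists_walk_length_eq_dist u v

theorem IsGeodesicSpace.contractionDist_le_one_add (hX : IsGeodesicSpace X) {x y z : X}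
    (h : dist x y ≤ 1) : contractionDist K z y ≤ contractionDist K z x + 1 :=
  (hX.contractionDist_triangle z x y).trans
    (Nat.add_le_add_left (contractionDist_le_one_of_dist_le h) _)

/-- Along a segment, the contraction distance to the origin takes every value that does not
exceed its largest one. -/
theorem IsSegment.exists_contractionDist_eq (hX : IsGeodesicSpace X) {A : Set X} {m y : X}
    (h : IsSegment A m y) (n : ℕ) :
    (∃ u ∈ A, contractionDist K m u = n + 1) ∨ contractionDist K m y ≤ n := by
  obtain ⟨γ, ⟨hγ, h0, h1⟩, rfl⟩ := h
  set l := dist m y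
  have hmem : ∀ k : ℕ, min (k : ℝ) l ∈ Set.Icc 0 l := fun k =>
    ⟨le_min (Nat.cast_nonneg k) dist_nonneg, min_le_right _ _⟩
  by_cases hk : ∃ k : ℕ, n + 1 ≤ contractionDist K m (γ (min (k : ℝ) l))
  · left
    classical
    have hs := Nat.find_spec hk
    set k := Nat.find hk with hkdef
    refine ⟨γ (min (k : ℝ) l), ⟨_, hmem k, rfl⟩, le_antisymm ?_ hs⟩
    rcases Nat.eq_zero_or_pos k with h | h
    · rw [h] at hs ⊢
      have : min ((0 : ℕ) : ℝ) l = 0 := by simp [l]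
      rw [this, h0]
      simp
    · have hlt : ¬ n + 1 ≤ contractionDist K m (γ (min ((k - 1 : ℕ) : ℝ) l)) :=
        Nat.find_min hk (by omega)
      have hd : dist (γ (min ((k - 1 : ℕ) : ℝ) l)) (γ (min (k : ℝ) l)) ≤ 1 := by
        rw [hγ.2 _ (hmem _) _ (hmem _), Nat.cast_sub h]
        refine (abs_min_sub_min_le_max _ _ _ _).trans ?_
        simp
      have := hX.contractionDist_le_one_add (K := K) (z := m) hd
      omega
  · right
    push Not at hk
    have := hk ⌈l⌉₊
    rw [min_eq_right (Nat.le_ceil l), h1] at this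
    omega

/-- For large `D`, `a * (D + 1) ≤ 2 ^ (D - b - 1)`, so the right-hand side is at most `D - 1`. This
closes the logarithmic estimate in `IsCoarseLine.exists_close`. -/
theorem exists_bound_of_le_clog (a b : ℕ) :
    ∃ H : ℕ, ∀ D : ℕ, D ≤ Nat.clog 2 (a * (D + 1)) + b → D ≤ H := by
  refine ⟨4 * (a * 2 ^ (b + 1)) + b + 1, fun D hD => ?_⟩
  by_contra hlt
  push Not at hlt
  set c := a * 2 ^ (b + 1) with hc
  have key : c * (D + 1) ≤ 2 ^ D := by
    have h1 : D / 2 + 1 ≤ 2 ^ (D / 2) := Nat.lt_two_pow_self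
    have h2 : 2 ^ (D / 2) * 2 ^ (D / 2) ≤ 2 ^ D := by
      rw [← pow_add]
      exact Nat.pow_le_pow_right (by norm_num) (by omega)
    have h3 : D + 1 ≤ 2 * (D / 2 + 1) := by omega
    have h4 : 2 * c ≤ D / 2 + 1 := by omega
    calc c * (D + 1) ≤ c * (2 * (D / 2 + 1)) := Nat.mul_le_mul_left _ h3
      _ = (2 * c) * (D / 2 + 1) := by ring
      _ ≤ (D / 2 + 1) * (D / 2 + 1) := Nat.mul_le_mul_right _ h4
      _ ≤ 2 ^ (D / 2) * 2 ^ (D / 2) := Nat.mul_le_mul h1 h1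
      _ ≤ 2 ^ D := h2
  have key2 : a * (D + 1) ≤ 2 ^ (D - (b + 1)) := by
    refine Nat.le_of_mul_le_mul_right (c := 2 ^ (b + 1)) ?_ (by positivity)
    rw [← pow_add, Nat.sub_add_cancel (by omega)]
    calc _ = c * (D + 1) := by rw [hc]; ring
      _ ≤ _ := key
  have := Nat.clog_le_of_le_pow key2
  omega

/-- Quasi-geodesics of the contraction graph: the points `x n` are coarsely evenly spread. -/
structure IsCoarseLine (K : ℝ≥0 → ℝ≥0∞) (C : ℕ) (x : ℤ → X) : Prop where
  step : ∀ n, contractionDist K (x n) (x (n + 1)) ≤ C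
  spread : ∀ i j, (i - j).natAbs ≤ C * contractionDist K (x i) (x j) + C

theorem IsCoarseLine.exists_walk (hX : IsGeodesicSpace X) {C : ℕ} {x : ℤ → X}
    (hx : IsCoarseLine K C x) (k : ℤ) (n : ℕ) :
    ∃ p : (contractionGraph K X).Walk (x k) (x (k + n)), p.length ≤ C * n ∧
      ∀ v ∈ p.support, ∃ l, k ≤ l ∧ l ≤ k + n ∧ contractionDist K (x l) v ≤ C := by
  induction n with
  | zero =>
    refine ⟨SimpleGraph.Walk.nil.copy rfl (by simp), by simp, fun v hv => ?_⟩
    have : v = x k := by simpa using hv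
    exact ⟨k, le_rfl, by simp, by simp [this]⟩
  | succ n ih =>
    obtain ⟨p, hp, hv⟩ := ih
    obtain ⟨q, hq⟩ := hX.exists_walk (K := K) (x (k + n)) (x (k + n + 1))
    have hstep := hx.step (k + n)
    refine ⟨(p.append q).copy rfl (by push_cast; ring_nf), ?_, fun v hv' => ?_⟩
    · rw [SimpleGraph.Walk.length_copy, SimpleGraph.Walk.length_append, mul_add]
      omega
    · rw [SimpleGraph.Walk.support_copy, SimpleGraph.Walk.mem_support_append_iff] at hv'
      rcases hv' with hv' | hv'
      · obtain ⟨l, h1, h2, h3⟩ := hv v hv'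
        exact ⟨l, h1, by push_cast; omega, h3⟩
      · exact ⟨k + n, by omega, by push_cast; omega,
          (contractionDist_le_length q hv').trans (by omega)⟩

theorem IsCoarseLine.exists_walk_between (hX : IsGeodesicSpace X) {C : ℕ} {x : ℤ → X}
    (hx : IsCoarseLine K C x) {i j k l : ℤ} (hk : k ∈ Set.Icc i j) (hl : l ∈ Set.Icc i j) :
    ∃ p : (contractionGraph K X).Walk (x k) (x l), p.length ≤ C * (k - l).natAbs ∧
      ∀ v ∈ p.support, ∃ n ∈ Set.Icc i j, contractionDist K (x n) v ≤ C := by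
  rcases le_total k l with h | h
  · obtain ⟨p, hp, hv⟩ := hx.exists_walk hX k (l - k).toNat
    have e : k + ((l - k).toNat : ℤ) = l := by omega
    refine ⟨p.copy rfl (by rw [e]), ?_, fun v hv' => ?_⟩
    · rw [SimpleGraph.Walk.length_copy]
      exact hp.trans (Nat.mul_le_mul_left _ (by omega))
    · obtain ⟨n, h1, h2, h3⟩ := hv v (by simpa using hv')
      exact ⟨n, ⟨hk.1.trans h1, (h2.trans e.le).trans hl.2⟩, h3⟩
  · obtain ⟨p, hp, hv⟩ := hx.exists_walk hX l (k - l).toNat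
    have e : l + ((k - l).toNat : ℤ) = k := by omega
    refine ⟨(p.copy rfl (by rw [e])).reverse, ?_, fun v hv' => ?_⟩
    · rw [SimpleGraph.Walk.length_reverse, SimpleGraph.Walk.length_copy]
      exact hp.trans (Nat.mul_le_mul_left _ (by omega))
    · obtain ⟨n, h1, h2, h3⟩ := hv v (by simpa using hv')
      exact ⟨n, ⟨hl.1.trans h1, (h2.trans e.le).trans hk.2⟩, h3⟩

/-- Geodesics of `X` joining two points of a quasi-geodesic of the contraction graph stay close,
for the contraction distance, to the part of the quasi-geodesic between these points. -/
theorem IsCoarseLine.exists_close (hX : IsGeodesicSpace X) (hK : IsContractionGauge K) {C : ℕ}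
    {x : ℤ → X} (hx : IsCoarseLine K C x) :
    ∃ H : ℕ, ∀ i j, i ≤ j → ∀ A, IsSegment A (x i) (x j) → ∀ m ∈ A,
      ∃ k ∈ Set.Icc i j, contractionDist K m (x k) ≤ H := by
  obtain ⟨H, hH⟩ := exists_bound_of_le_clog (2 + 6 * C * C) (C + 1)
  refine ⟨H, fun i j hij A hA => ?_⟩
  -- Each segment separately admits some bound; the least one, `D`, is then shown to be at most `H`.
  have hex : ∃ D : ℕ, ∀ m ∈ A, ∃ k ∈ Set.Icc i j, contractionDist K m (x k) ≤ D := by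
    refine ⟨⌈dist (x i) (x j)⌉₊, fun m hm => ⟨i, ⟨le_rfl, hij⟩, hX.contractionDist_le ?_⟩⟩
    refine le_trans ?_ (Nat.le_ceil _)
    rw [dist_comm, ← hA.dist_add_dist hm]
    simp
  classical
  have hD := Nat.find_spec hex
  set D := Nat.find hex with hDdef
  have hDH : D ≤ H := by
    rcases Nat.eq_zero_or_pos D with h0 | hpos
    · omega
    have hmin : ¬ ∀ m ∈ A, ∃ k ∈ Set.Icc i j, contractionDist K m (x k) ≤ D - 1 :=
      Nat.find_min hex (by omega)
    push Not at hmin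
    obtain ⟨m, hm, hfar⟩ := hmin
    -- On either side of `m`, follow the geodesic to contraction distance `2D + 1`, or to its end if
    -- that distance is not reached, then join the coarse line by a path of length at most `D`. That
    -- path stays at distance at least `D` from `m`.
    have side : ∀ e ∈ Set.Icc i j, ∀ B ⊆ A, IsSegment B m (x e) →
        ∃ u ∈ B, contractionDist K m u ≤ 2 * D + 1 ∧ ∃ k ∈ Set.Icc i j,
          contractionDist K u (x k) ≤ D ∧
          ∃ p : (contractionGraph K X).Walk u (x k), p.length ≤ D ∧
            ∀ w ∈ p.support, D ≤ contractionDist K m w := by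
      intro e he B hBA hB
      rcases hB.exists_contractionDist_eq hX (K := K) (2 * D) with ⟨u, hu, hmu⟩ | hle
      · obtain ⟨k, hk, huk⟩ := hD u (hBA hu)
        obtain ⟨p, hp⟩ := hX.exists_walk (K := K) u (x k)
        refine ⟨u, hu, hmu.le, k, hk, huk, p, by omega, fun w hw => ?_⟩
        have h1 := contractionDist_le_length p hw
        have h2 := hX.contractionDist_triangle (K := K) m w u
        rw [contractionDist_comm w u] at h2
        omega
      · refine ⟨x e, hB.right_mem, by omega, e, he, by simp, SimpleGraph.Walk.nil, by simp,
          fun w hw => ?_⟩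
        have : w = x e := by simpa using hw
        have h1 := hfar e he
        rw [this]
        omega
    obtain ⟨A₁, A₂, hA₁, hA₂, hAA⟩ := hA.exists_split hm
    obtain ⟨u, hu, hmu, k, hk, huk, p, hp, hpf⟩ :=
      side i ⟨le_rfl, hij⟩ A₁ (hAA ▸ Set.subset_union_left) hA₁.symm
    obtain ⟨v, hv, hmv, l, hl, hvl, q, hq, hqf⟩ :=
      side j ⟨hij, le_rfl⟩ A₂ (hAA ▸ Set.subset_union_right) hA₂
    obtain ⟨s, hs, hsf⟩ := hx.exists_walk_between hX hk hl
    have hbet : dist u m + dist m v = dist u v := by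
      have d1 := hA₁.dist_add_dist hu
      have d2 := hA₂.dist_add_dist hv
      have d3 := hA.dist_add_dist hm
      have d4 := dist_triangle4 (x i) u v (x j)
      have d5 := dist_triangle u m v
      linarith
    obtain ⟨E, hE, hmE⟩ := hX.exists_isSegment_mem hbet
    have hkl : contractionDist K (x k) (x l) ≤ 6 * D + 2 := by
      have t1 := hX.contractionDist_triangle (K := K) (x k) u (x l)
      have t2 := hX.contractionDist_triangle (K := K) u m (x l)
      have t3 := hX.contractionDist_triangle (K := K) m v (x l)
      rw [contractionDist_comm (x k) u] at t1
      rw [contractionDist_comm u m] at t2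
      omega
    have hspread := hx.spread k l
    -- The detour through `u`, `x k`, `x l`, `v` has length linear in `D` and avoids the ball of
    -- radius `D - C` about `m`, while the geodesic `E` through `m` is logarithmically close to it.
    have hlen : ((p.append s).append q.reverse).length ≤ (2 + 6 * C * C) * (D + 1) := by
      rw [SimpleGraph.Walk.length_append, SimpleGraph.Walk.length_append,
        SimpleGraph.Walk.length_reverse]
      have h1 : (k - l).natAbs ≤ C * (6 * D + 2) + C :=
        hspread.trans (Nat.add_le_add_right (Nat.mul_le_mul_left _ hkl) _)
      have h2 : C * (k - l).natAbs ≤ C * (C * (6 * D + 2) + C) := Nat.mul_le_mul_left _ h1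
      nlinarith [Nat.zero_le (C * C)]
    obtain ⟨w, hw, hmw⟩ := hX.exists_mem_support hK (Nat.clog 2 ((2 + 6 * C * C) * (D + 1))) _
      (hlen.trans (Nat.le_pow_clog (by norm_num) _)) hE hmE
    refine hH D ?_
    rw [SimpleGraph.Walk.mem_support_append_iff, SimpleGraph.Walk.mem_support_append_iff,
      SimpleGraph.Walk.support_reverse, List.mem_reverse] at hw
    rcases hw with (hw | hw) | hw
    · have := hpf w hw; omega
    · obtain ⟨n, hn, hnw⟩ := hsf w hw
      have h1 := hfar n hn
      have h2 := hX.contractionDist_triangle (K := K) m w (x n)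
      rw [contractionDist_comm w (x n)] at h2
      omega
    · have := hqf w hw; omega
  intro m hm
  obtain ⟨k, hk, hmk⟩ := hD m hm
  exact ⟨k, hk, hmk.trans hDH⟩

end Stability

/-! ### Thin points on geodesics between points of a coarse line. -/

section ThinPoints

variable {X : Type*} [MetricSpace X] {K : ℝ≥0 → ℝ≥0∞}

/-- `m` lies on a geodesic from `x` to `y` and is `r`-close to the other sides of every
quadrangle having this geodesic as a side. -/
def IsThinPoint (r : ℝ) (x y m : X) : Prop :=
  ∃ A, IsSegment A x y ∧ m ∈ A ∧ ∀ (z w : X) (B C D : Set X), IsSegment B y z → IsSegment C z w →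
    IsSegment D w x → ∃ p ∈ B ∪ C ∪ D, dist p m ≤ r

theorem IsThinPoint.symm {r : ℝ} {x y m : X} (h : IsThinPoint r x y m) : IsThinPoint r y x m := by
  obtain ⟨A, hA, hm, h⟩ := h
  refine ⟨A, hA.symm, hm, fun z w B C D hB hC hD => ?_⟩
  obtain ⟨p, hp, hpm⟩ := h w z D C B hD.symm hC.symm hB.symm
  exact ⟨p, by rcases hp with (hp | hp) | hp <;> simp [hp], hpm⟩

theorem IsThinPoint.smul {G : Type*} [Group G] [MulAction G X] [IsIsometricSMul G X] (g : G)
    {r : ℝ} {x y m : X} (h : IsThinPoint r x y m) : IsThinPoint r (g • x) (g • y) (g • m) := by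
  obtain ⟨A, hA, hm, h⟩ := h
  refine ⟨_, hA.smul g, ⟨m, hm, rfl⟩, fun z w B C D hB hC hD => ?_⟩
  have hB' := hB.smul g⁻¹
  have hD' := hD.smul g⁻¹
  rw [inv_smul_smul] at hB' hD'
  obtain ⟨p, hp, hpm⟩ := h _ _ _ _ _ hB' (hC.smul g⁻¹) hD'
  rw [← Set.image_union, ← Set.image_union] at hp
  obtain ⟨q, hq, rfl⟩ := hp
  refine ⟨q, hq, ?_⟩
  rw [← dist_smul g, smul_inv_smul] at hpm
  exact hpm

/-- A piece of a geodesic whose endpoints are far apart in the contraction graph is close to a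
thin point. -/
theorem IsGeodesicFromTo.exists_isThinPoint (hK : IsContractionGauge K) {σ : ℝ → X} {x y : X}
    (hσ : IsGeodesicFromTo σ x y) {s t L : ℝ} (hs : 0 ≤ s) (hst : s ≤ t) (ht : t ≤ dist x y)
    (hL : t - s ≤ L) (hρ : 1 < contractionDist K (σ s) (σ t)) :
    ∃ m, IsThinPoint L x y m ∧ dist (σ s) m ≤ L := by
  obtain ⟨hσ, h0, h1⟩ := hσ
  have hd := hσ.dist_eq hs hst ht
  have hdx := hσ.dist_eq le_rfl hs (hst.trans ht)
  have hdy := hσ.dist_eq (hs.trans hst) ht le_rfl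
  rw [h0, sub_zero] at hdx
  rw [h1] at hdy
  have hlt : 1 < dist (σ s) (σ t) := by
    by_contra h
    exact absurd (contractionDist_le_one_of_dist_le (K := K) (not_lt.1 h)) (not_le.2 hρ)
  have hna : ¬ IsAntiContracting K (σ s) (σ t) := fun h =>
    absurd h.contractionDist_le_one (not_le.2 hρ)
  rw [IsAntiContracting] at hna
  push Not at hna
  -- The thin piece lies on some geodesic `γ` with the same ends, which is spliced into `σ`. Its
  -- scale is not prescribed, but `4r + 1 ≤ b - a ≤ L` bounds it by `L`.
  obtain ⟨r, γ, hγ, a, b, ha, hab, hb, hr, hthin⟩ := hna hlt.le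
  have hr := hK.le_of_le hr
  have hα : IsGeodesicFromTo σ x (σ s) :=
    ⟨by rw [hdx]; exact hσ.mono le_rfl hs (hst.trans ht), h0, by rw [hdx]⟩
  have hβ := (hσ.mono (hs.trans hst) ht le_rfl).isGeodesicFromTo
  rw [h1] at hβ
  have hdxt := hσ.dist_eq le_rfl (hs.trans hst) ht
  rw [h0, sub_zero] at hdxt
  obtain ⟨δ₁, hδ₁, -, e₁⟩ := hα.exists_concat hγ (by linarith)
  obtain ⟨δ, hδ, e₂, -⟩ := hδ₁.exists_concat hβ (by linarith)
  have e : ∀ u ∈ Set.Icc a b, δ (u + s) = γ u := by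
    intro u hu
    rw [e₂ (u + s) ⟨by linarith [hu.1], by linarith [hu.2]⟩, ← e₁ u ⟨by linarith [hu.1],
      by linarith [hu.2]⟩, hdx]
  have hthin' := hthin.translate hab e
  have em : δ ((a + s + (b + s)) / 2) = γ ((a + b) / 2) := by
    rw [← e _ ⟨by linarith, by linarith⟩]; congr 1; ring
  refine ⟨γ ((a + b) / 2), ⟨_, hδ.isSegment, ⟨(a + s + (b + s)) / 2, ⟨by linarith, by linarith⟩,
    em⟩, fun z w B C D hB hC hD => ?_⟩, ?_⟩
  · obtain ⟨p, hp, hpd⟩ := hthin'.exists_dist_le hδ (by linarith) (by linarith) hB hC hD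
    rw [em] at hpd
    exact ⟨p, hp, by linarith [r.coe_nonneg]⟩
  · have := hγ.1.dist_eq le_rfl (by linarith : (0 : ℝ) ≤ (a + b) / 2) (by linarith)
    rw [hγ.2.1] at this
    linarith

/-- On long geodesics joining points of a quasi-geodesic of the contraction graph there are thin
points, with uniform constants, far from both endpoints. -/
theorem IsCoarseLine.exists_isThinPoint (hX : IsGeodesicSpace X) (hK : IsContractionGauge K)
    {C : ℕ} {x : ℤ → X} (hx : IsCoarseLine K C x) (c : ℕ)
    (hc : ∀ n : ℕ, dist (x 0) (x n) ≤ c * n) :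
    ∃ r : ℕ, ∀ Q : ℕ, ∃ (n : ℕ) (m : X), IsThinPoint r (x 0) (x n) m ∧
      Q ≤ contractionDist K m (x 0) ∧ Q ≤ contractionDist K m (x n) := by
  -- If the contraction distance grew by at most one per piece of length `L`, it would be about `c *
  -- n / L < n / (2C)` between `x 0` and `x n`, too little for `spread`.
  set L : ℕ := 2 * c * C + 1 with hL
  refine ⟨L, fun Q => ?_⟩
  by_contra hno
  push Not at hno
  set n : ℕ := 2 * C * (2 * (Q + L) + L + 4) + 1 with hn
  obtain ⟨σ, hσ⟩ := hX (x 0) (x n)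
  set l := dist (x 0) (x n) with hl
  have hL0 : (0 : ℝ) < L := by rw [hL]; positivity
  set N := ⌈l / L⌉₊ with hN
  have hNl : l ≤ N * L := by
    have := Nat.le_ceil (l / L)
    rwa [div_le_iff₀ hL0] at this
  have hNn : N * L ≤ c * n + L := by
    have h1 : (N : ℝ) < l / L + 1 := Nat.ceil_lt_add_one (div_nonneg dist_nonneg hL0.le)
    have h2 : (N : ℝ) * L < l + L := by
      have := mul_lt_mul_of_pos_right h1 hL0
      rwa [add_mul, one_mul, div_mul_cancel₀ _ hL0.ne'] at this
    have h3 := hc n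
    have h4 : (N : ℝ) * L ≤ c * n + L := by linarith
    exact_mod_cast h4
  set τ : ℕ → X := fun k => σ (min (k * L) l) with hτ
  have hmem : ∀ k : ℕ, min ((k : ℝ) * L) l ∈ Set.Icc 0 l := fun k =>
    ⟨le_min (by positivity) dist_nonneg, min_le_right _ _⟩
  have hle : ∀ k : ℕ, min ((k : ℝ) * L) l ≤ min (((k + 1 : ℕ) : ℝ) * L) l := fun k =>
    min_le_min_right _ (by push_cast; linarith)
  have hgap : ∀ k : ℕ, min (((k + 1 : ℕ) : ℝ) * L) l - min ((k : ℝ) * L) l ≤ L := by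
    intro k
    refine (le_abs_self _).trans ((abs_min_sub_min_le_max _ _ _ _).trans ?_)
    push_cast
    rw [add_mul, one_mul, add_sub_cancel_left, sub_self, abs_zero, abs_of_pos hL0]
    exact max_le le_rfl hL0.le
  have hstep : ∀ k, contractionDist K (τ k) (τ (k + 1)) ≤ L := by
    intro k
    refine hX.contractionDist_le ?_
    rw [hσ.1.dist_eq (hmem k).1 (hle k) (hmem (k + 1)).2]
    exact hgap k
  -- A piece of contraction length above one has a thin point nearby, so by `hno` it starts near `x
  -- 0` or near `x n`.
  have hcases : ∀ k, contractionDist K (τ k) (τ (k + 1)) ≤ 1 ∨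
      contractionDist K (x 0) (τ k) < Q + L ∨ contractionDist K (τ k) (x n) < Q + L := by
    intro k
    by_contra! hk
    obtain ⟨m, hm, hmd⟩ := hσ.exists_isThinPoint hK (hmem k).1 (hle k) (hmem (k + 1)).2 (hgap k)
      hk.1
    have hρ : contractionDist K (τ k) m ≤ L := hX.contractionDist_le hmd
    have t1 := hX.contractionDist_triangle (K := K) (x 0) m (τ k)
    have t2 := hX.contractionDist_triangle (K := K) (τ k) m (x n)
    rw [contractionDist_comm m (τ k), contractionDist_comm (x 0) m] at t1
    have := hno n m hm (by omega)
    omega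
  -- Pieces starting near `x 0` leave the distance from `x 0` below `Q + 2L`; the others add at most
  -- one, until some piece starts near `x n`.
  have claim : ∀ k, contractionDist K (x 0) (τ k) ≤ Q + L + L + k ∨
      ∃ k' ≤ k, contractionDist K (τ k') (x n) < Q + L ∧
        contractionDist K (x 0) (τ k') ≤ Q + L + L + k' := by
    intro k
    induction k with
    | zero =>
      left
      have : τ 0 = x 0 := by
        simp only [hτ, Nat.cast_zero, zero_mul]
        rw [min_eq_left dist_nonneg, hσ.2.1]
      rw [this]
      simp
    | succ k ih =>
      rcases ih with ih | ⟨k', hk', h⟩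
      · have t1 := hX.contractionDist_triangle (K := K) (x 0) (τ k) (τ (k + 1))
        have := hstep k
        rcases hcases k with h | h | h
        · left; omega
        · left; omega
        · exact Or.inr ⟨k, by omega, h, ih⟩
      · exact Or.inr ⟨k', by omega, h⟩
  have hend : τ N = x n := by
    simp only [hτ]
    rw [min_eq_right hNl, hσ.2.2]
  have hρ : contractionDist K (x 0) (x n) ≤ 2 * (Q + L) + L + N := by
    rcases claim N with h | ⟨k', hk', h1, h2⟩
    · rw [hend] at h; omega
    · have := hX.contractionDist_triangle (K := K) (x 0) (τ k') (x n)
      omega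
  have hs := hx.spread 0 n
  have hs' : n ≤ C * (2 * (Q + L) + L + N) + C := by
    have := Nat.mul_le_mul_left C hρ
    have e : ((0 : ℤ) - n).natAbs = n := by omega
    omega
  have h2 : 2 * C * N ≤ n + 2 * C := by
    by_contra hlt
    push Not at hlt
    have h3 : (n + 2 * C) * L < 2 * C * N * L := Nat.mul_lt_mul_of_pos_right hlt (by omega)
    have h4 : 2 * C * (N * L) ≤ 2 * C * (c * n + L) := Nat.mul_le_mul_left _ hNn
    have h5 : (n + 2 * C) * L = n * (2 * c * C) + n + 2 * C * L := by rw [hL]; ring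
    nlinarith
  nlinarith

end ThinPoints

/-! ### Contraction of a sequence accompanied by thin points. -/

section ThinAxis

variable {X : Type*} [MetricSpace X] {K : ℝ≥0 → ℝ≥0∞}

/-- A sequence of points `x k` all of which are near thin points `m k` of geodesics from
`x (k - α)` to `x (k + β)`. -/
structure IsThinAxis (K : ℝ≥0 → ℝ≥0∞) (x m : ℤ → X) (α β : ℤ) (H r : ℕ) (B : ℝ) : Prop where
  nonneg_left : 0 ≤ α
  nonneg_right : 0 ≤ β
  close : ∀ i j, i ≤ j → ∀ A, IsSegment A (x i) (x j) → ∀ p ∈ A,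
    ∃ k ∈ Set.Icc i j, contractionDist K p (x k) ≤ H
  thin : ∀ k, IsThinPoint r (x (k - α)) (x (k + β)) (m k)
  near : ∀ k, contractionDist K (m k) (x k) ≤ H
  dist_le : ∀ k, dist (m k) (x k) ≤ B
  far : ∀ k l, l ≤ k - α ∨ k + β ≤ l → 2 * r + H + 1 < contractionDist K (m k) (x l)

namespace IsThinAxis

variable {x m : ℤ → X} {α β : ℤ} {H r : ℕ} {B : ℝ}

theorem reverse (h : IsThinAxis K x m α β H r B) :
    IsThinAxis K (fun k => x (-k)) (fun k => m (-k)) β α H r B where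
  nonneg_left := h.nonneg_right
  nonneg_right := h.nonneg_left
  close i j hij A hA p hp := by
    obtain ⟨k, hk, hkp⟩ := h.close (-j) (-i) (by omega) A hA.symm p hp
    exact ⟨-k, ⟨by have := hk.2; omega, by have := hk.1; omega⟩, by simpa using hkp⟩
  thin k := by
    have := (h.thin (-k)).symm
    rwa [show -(k - β) = -k + β by ring, show -(k + α) = -k - α by ring]
  near k := h.near _
  dist_le k := h.dist_le _
  far k l hl := h.far _ _ (by omega)

/-- The segment is contraction-close to points `x l` with `k + β ≤ l`, all of which are far from `m
k`. -/
theorem not_dist_le_of_right (h : IsThinAxis K x m α β H r B) (hX : IsGeodesicSpace X)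
    {k b : ℤ} (hb : k + β ≤ b) {A : Set X} (hA : IsSegment A (x (k + β)) (x b)) {p : X}
    (hp : p ∈ A) : ¬ dist p (m k) ≤ r := by
  intro hd
  obtain ⟨l, hl, hpl⟩ := h.close _ _ hb A hA p hp
  have h1 := h.far k l (Or.inr hl.1)
  have h2 : contractionDist K (m k) p ≤ r := hX.contractionDist_le (by rwa [dist_comm])
  have h3 := hX.contractionDist_triangle (K := K) (m k) p (x l)
  omega

theorem not_dist_le_of_left (h : IsThinAxis K x m α β H r B) (hX : IsGeodesicSpace X)
    {k a : ℤ} (ha : a ≤ k - α) {A : Set X} (hA : IsSegment A (x a) (x (k - α))) {p : X}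
    (hp : p ∈ A) : ¬ dist p (m k) ≤ r := by
  have := h.reverse.not_dist_le_of_right hX (k := -k) (b := -a) (A := A) (by omega)
    (by rw [show -(-k + α) = k - α by ring, neg_neg]; exact hA.symm) hp
  simpa using this

/-- If a point `w` is close to the thin point `m k` and `q` lies on a segment from `u` to `w`,
where `u` is an endpoint of the segment containing `m k`, then `q` is close, for the contraction
distance, to some point `x l` of the axis. -/
theorem exists_close_of_mem (h : IsThinAxis K x m α β H r B) (hX : IsGeodesicSpace X)
    (hK : IsContractionGauge K) {k : ℤ} {u w q : X} {D : Set X} (hw : dist w (m k) ≤ r)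
    (hu : u = x (k - α) ∨ u = x (k + β)) (hD : IsSegment D u w) (hq : q ∈ D) :
    ∃ l ∈ Set.Icc (k - α) (k + β), contractionDist K q (x l) ≤ 1 + r + H := by
  obtain ⟨A, hA, hmA, -⟩ := h.thin k
  have hle : k - α ≤ k + β := by have := h.nonneg_left; have := h.nonneg_right; omega
  have hsub : ∃ A' ⊆ A, IsSegment A' (m k) u := by
    obtain ⟨A₁, A₂, h₁, h₂, rfl⟩ := hA.exists_split hmA
    rcases hu with rfl | rfl
    · exact ⟨A₁, Set.subset_union_left, h₁.symm⟩
    · exact ⟨A₂, Set.subset_union_right, h₂⟩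
  obtain ⟨A', hA'A, hA'⟩ := hsub
  obtain ⟨E, hE⟩ := hX.exists_isSegment w (m k)
  -- In the triangle on `u`, `w`, `m k`, the side from `w` to `m k` is short and the side from `m k`
  -- to `u` follows the axis by `close`.
  obtain ⟨p, hp, hqp⟩ := hD.exists_contractionDist_le_one hK hE hA' hq
  rcases hp with hp | hp
  · refine ⟨k, ⟨by have := h.nonneg_left; omega, by have := h.nonneg_right; omega⟩, ?_⟩
    have h1 : contractionDist K p (m k) ≤ r := by
      refine hX.contractionDist_le ?_
      have := hE.dist_add_dist hp
      linarith [dist_nonneg (x := w) (y := p)]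
    have h2 := hX.contractionDist_triangle (K := K) q p (x k)
    have h3 := hX.contractionDist_triangle (K := K) p (m k) (x k)
    have h4 := h.near k
    omega
  · obtain ⟨l, hl, hpl⟩ := h.close _ _ hle A hA p (hA'A hp)
    have h2 := hX.contractionDist_triangle (K := K) q p (x l)
    exact ⟨l, hl, by omega⟩

/-- A geodesic from a point `y` to `x (k - α)` avoids the thin point `m k` if `y` is
almost closest to a point `x a` far to the left of `x k`. -/
theorem not_dist_le_of_closest (h : IsThinAxis K x m α β H r B) (hX : IsGeodesicSpace X)
    (hK : IsContractionGauge K) {y : X} {a k : ℤ} {c : ℝ}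
    (hy : ∀ j, dist y (x a) ≤ dist y (x j) + c) (ha : a ≤ k - α - β - α)
    (hd : 2 * (r + B) + c < dist (x a) (x (k - α - β))) {D : Set X}
    (hD : IsSegment D y (x (k - α))) {w : X} (hw : w ∈ D) : ¬ dist w (m k) ≤ r := by
  intro hwm
  -- The neighbouring thin point `m (k - α - β)` belongs to a geodesic ending at `x (k - α)`; it is
  -- tested on the quadrangle through `y` and `x a`. If `D` passes near both thin points, the
  -- passage nearer to `x (k - α)` is contraction-close to a stretch of the axis far from its own
  -- thin point.
  obtain ⟨_, -, -, hthin⟩ := h.thin (k - α - β)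
  rw [show k - α - β + β = k - α by ring] at hthin
  obtain ⟨E, hE⟩ := hX.exists_isSegment y (x a)
  obtain ⟨F, hF⟩ := hX.exists_isSegment (x a) (x (k - α - β - α))
  obtain ⟨q, hq, hqm⟩ := hthin _ _ _ _ _ hD.symm hE hF
  rcases hq with (hq | hq) | hq
  -- Here the whole constant `2r + H + 1` of `far` is used: `r` from `p` to the thin point and `1 +
  -- r + H` from `p` to the axis.
  · have tri : ∀ {n l : ℤ} {p : X}, dist p (m n) ≤ r →
        contractionDist K p (x l) ≤ 1 + r + H → (l ≤ n - α ∨ n + β ≤ l) → False := by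
      intro n l p hp hpl hl
      have h1 := h.far n l hl
      have h2 : contractionDist K (m n) p ≤ r := hX.contractionDist_le (by rwa [dist_comm])
      have h3 := hX.contractionDist_triangle (K := K) (m n) p (x l)
      omega
    rcases hD.symm.exists_subsegment hw hq with ⟨S, hS, hwS⟩ | ⟨S, hS, hqS⟩
    · obtain ⟨l, hl, hwl⟩ := h.exists_close_of_mem hX hK hqm
        (Or.inr (by rw [show k - α - β + β = k - α by ring])) hS hwS
      exact tri hwm hwl (Or.inl (by have := hl.2; omega))
    · obtain ⟨l, hl, hql⟩ := h.exists_close_of_mem hX hK hwm (Or.inl rfl) hS hqS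
      exact tri hqm hql (Or.inr (by have := hl.1; omega))
  -- Passing near `x (k - α - β)` on the way to `x a` contradicts that `x a` is almost closest to
  -- `y` and far from that point.
  · have h1 := hE.dist_add_dist hq
    have h2 := hy (k - α - β)
    have h3 := dist_triangle y q (x (k - α - β))
    have h4 := dist_triangle q (m (k - α - β)) (x (k - α - β))
    have h5 := h.dist_le (k - α - β)
    have h6 := dist_triangle (x a) q (x (k - α - β))
    rw [dist_comm (x a) q] at h6
    linarith
  · exact h.not_dist_le_of_left hX ha hF hq hqm

/-- Geodesics between points with almost closest points far apart on the axis pass near the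
axis. -/
theorem exists_mem_dist_le (h : IsThinAxis K x m α β H r B) (hX : IsGeodesicSpace X)
    (hK : IsContractionGauge K) {y z : X} {a b k : ℤ} {c : ℝ}
    (hy : ∀ j, dist y (x a) ≤ dist y (x j) + c) (hz : ∀ j, dist z (x b) ≤ dist z (x j) + c)
    (ha : a ≤ k - α - β - α) (hb : k + α + β + β ≤ b)
    (hda : 2 * (r + B) + c < dist (x a) (x (k - α - β)))
    (hdb : 2 * (r + B) + c < dist (x b) (x (k + α + β))) :
    ∃ p, dist y p + dist p z = dist y z ∧ dist p (x k) ≤ r + B := by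
  obtain ⟨_, -, -, hthin⟩ := h.thin k
  obtain ⟨D, hD⟩ := hX.exists_isSegment (x (k + β)) z
  obtain ⟨E, hE⟩ := hX.exists_isSegment z y
  obtain ⟨F, hF⟩ := hX.exists_isSegment y (x (k - α))
  obtain ⟨p, hp, hpm⟩ := hthin _ _ _ _ _ hD hE hF
  rcases hp with (hp | hp) | hp
  · refine absurd hpm ?_
    have := h.reverse.not_dist_le_of_closest hX hK (y := z) (a := -b) (k := -k) (c := c) (D := D)
      (w := p) (fun j => by simpa using hz (-j)) (by omega)
      (by rw [neg_neg, show -(-k - β - α) = k + α + β by ring]; exact hdb)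
      (by rw [show -(-k - β) = k + β by ring]; exact hD.symm) hp
    simpa using this
  · refine ⟨p, hE.symm.dist_add_dist hp, ?_⟩
    have := dist_triangle p (m k) (x k)
    have := h.dist_le k
    linarith
  · exact absurd hpm (h.not_dist_le_of_closest hX hK hy ha hda hF hp)

/-- Otherwise a geodesic from `y` to `z` passes near some `x k` far from `x b`. As `z` is closer to
`y` than `x k` is, `z` lies within `2(r + B)` of `x k`, and then its almost closest point `x b`
would be near `x k` too. -/
theorem sub_lt_of_dist_lt (h : IsThinAxis K x m α β H r B) (hX : IsGeodesicSpace X)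
    (hK : IsContractionGauge K) {y z : X} {a b : ℤ} {c : ℝ} {M : ℕ}
    (hM : ∀ i j : ℤ, M ≤ (i - j).natAbs → 4 * (r + B) + c < dist (x i) (x j))
    (hy : ∀ j, dist y (x a) ≤ dist y (x j) + c) (hz : ∀ j, dist z (x b) ≤ dist z (x j) + c)
    (hyz : ∀ j, dist y z < dist y (x j)) : b - a < 2 * M + 3 * α + 3 * β := by
  by_contra hlt
  push Not at hlt
  have hα := h.nonneg_left
  have hβ := h.nonneg_right
  have hB : 0 ≤ (r : ℝ) + B := add_nonneg (Nat.cast_nonneg r) (dist_nonneg.trans (h.dist_le 0))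
  set k := a + M + 2 * α + β with hk
  have ha := hM a (k - α - β) (by omega)
  have hb := hM b (k + α + β) (by omega)
  have hbk := hM k b (by omega)
  obtain ⟨p, hp, hpk⟩ := h.exists_mem_dist_le hX hK hy hz (k := k) (by omega) (by omega)
    (by linarith) (by linarith)
  have h1 := hyz k
  have h2 := dist_triangle y p (x k)
  have h3 := dist_triangle (x k) p z
  rw [dist_comm (x k) p] at h3
  have h4 := hz k
  have h5 := dist_triangle (x k) z (x b)
  rw [dist_comm (x k) z] at h3 h5
  linarith

theorem natAbs_sub_lt_of_dist_lt (h : IsThinAxis K x m α β H r B) (hX : IsGeodesicSpace X)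
    (hK : IsContractionGauge K) {y z : X} {a b : ℤ} {c : ℝ} {M : ℕ}
    (hM : ∀ i j : ℤ, M ≤ (i - j).natAbs → 4 * (r + B) + c < dist (x i) (x j))
    (hy : ∀ j, dist y (x a) ≤ dist y (x j) + c) (hz : ∀ j, dist z (x b) ≤ dist z (x j) + c)
    (hyz : ∀ j, dist y z < dist y (x j)) : |b - a| < 2 * M + 3 * α + 3 * β := by
  rw [abs_lt]
  have h1 := h.sub_lt_of_dist_lt hX hK hM hy hz hyz
  have h2 := h.reverse.sub_lt_of_dist_lt hX hK (a := -a) (b := -b) (c := c) (M := M)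
    (fun i j hij => hM (-i) (-j) (by omega)) (fun j => by simpa using hy (-j))
    (fun j => by simpa using hz (-j)) (fun j => hyz (-j))
  constructor <;> omega

end IsThinAxis

end ThinAxis

/-! ### Comparison of the contraction space with the contraction graph. -/

section PointDist

variable {X : Type*} [MetricSpace X] {K : ℝ≥0 → ℝ≥0∞}

namespace PreContractionSpace

theorem dist_le_of_walk {a b : PreContractionSpace K X} {l : ℝ} (h : Walk a b l) : dist a b ≤ l :=
  csInf_le ⟨0, fun _ hl => hl.nonneg⟩ h

theorem dist_point_le (x y : X) : dist (point x : PreContractionSpace K X) (point y) ≤ dist x y :=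
  dist_le_of_walk (by simpa using Walk.inSpace (K := K) x y (Walk.nil (point y)))

theorem dist_point_le_one {x y : X} (h : IsAntiContracting K x y) :
    dist (point x : PreContractionSpace K X) (point y) ≤ 1 := by
  have w := Walk.unglue (Glue.source ⟨(x, y), h⟩) (Walk.inEdge ⟨(x, y), h⟩ 0 1
    (Walk.glue (Glue.target ⟨(x, y), h⟩) (Walk.nil _)))
  refine (dist_le_of_walk w).trans ?_
  rw [Subtype.dist_eq]
  simp

/-- With `dist_point_le`, this carries lower bounds along an orbit from the contraction space to the
graph and to `X`; no converse comparison is needed. -/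
theorem dist_point_le_contractionDist (hX : IsGeodesicSpace X) (x y : X) :
    dist (point x : PreContractionSpace K X) (point y) ≤ contractionDist K x y := by
  obtain ⟨p, hp⟩ := hX.exists_walk (K := K) x y
  rw [← hp]
  clear hp
  induction p with
  | nil => simp
  | @cons u v w hadj q ih =>
    have h1 : dist (point u : PreContractionSpace K X) (point v) ≤ 1 := by
      rcases (contractionGraph_adj.1 hadj).2 with h | h | h
      · exact (dist_point_le u v).trans h
      · exact dist_point_le_one h
      · rw [dist_comm]; exact dist_point_le_one h
    have h2 := dist_triangle (point u : PreContractionSpace K X) (point v) (point w)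
    rw [SimpleGraph.Walk.length_cons]
    push_cast
    linarith

end PreContractionSpace

end PointDist

/-! ### Orbits of cyclic groups. -/

section OrbitBounds

variable {G : Type*} [Group G] {Y : Type*}

/-- Being loxodromic does not depend on the base point. -/
theorem IsLoxodromic.exists_bound [MetricSpace Y] [MulAction G Y] [IsIsometricSMul G Y] {g : G}
    (h : IsLoxodromic Y g) (y : Y) :
    ∃ C : ℝ, 1 ≤ C ∧ ∀ m n : ℤ, |(m : ℝ) - n| / C - C ≤ dist (g ^ m • y) (g ^ n • y) ∧
      dist (g ^ m • y) (g ^ n • y) ≤ C * |(m : ℝ) - n| + C := by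
  obtain ⟨z, C, hC, h⟩ := h
  have hd := dist_nonneg (x := y) (y := z)
  refine ⟨C + 2 * dist y z, by linarith, fun m n => ?_⟩
  have h1 := dist_smul (g ^ m) y z
  have h2 := dist_smul (g ^ n) y z
  have h3 := dist_triangle4 (g ^ m • y) (g ^ m • z) (g ^ n • z) (g ^ n • y)
  have h4 := dist_triangle4 (g ^ m • z) (g ^ m • y) (g ^ n • y) (g ^ n • z)
  rw [dist_comm (g ^ n • z) (g ^ n • y)] at h3
  rw [dist_comm (g ^ m • z) (g ^ m • y)] at h4
  have h5 : |(m : ℝ) - n| / (C + 2 * dist y z) ≤ |(m : ℝ) - n| / C :=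
    div_le_div_of_nonneg_left (abs_nonneg _) (by linarith) (by linarith)
  have h6 : 0 ≤ 2 * dist y z * |(m : ℝ) - n| := by positivity
  have := h m n
  constructor <;> nlinarith

theorem dist_zpow_smul_le [PseudoMetricSpace Y] [MulAction G Y] [IsIsometricSMul G Y] (g : G)
    (y : Y) (m n : ℤ) : dist (g ^ m • y) (g ^ n • y) ≤ dist y (g • y) * |(m : ℝ) - n| := by
  have key : ∀ (m : ℤ) (k : ℕ), dist (g ^ m • y) (g ^ (m + k) • y) ≤ dist y (g • y) * k := by
    intro m k
    induction k with
    | zero => simp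
    | succ k ih =>
      have h1 := dist_triangle (g ^ m • y) (g ^ (m + k) • y) (g ^ (m + (k + 1 : ℕ)) • y)
      have h2 : dist (g ^ (m + k) • y) (g ^ (m + (k + 1 : ℕ)) • y) = dist y (g • y) := by
        rw [Nat.cast_succ, ← add_assoc, zpow_add_one, mul_smul, dist_smul]
      push_cast at *
      linarith
  rcases le_total m n with h | h
  · have := key m (n - m).toNat
    rw [show m + ((n - m).toNat : ℤ) = n by omega] at this
    refine this.trans_eq ?_
    rw [abs_sub_comm, abs_of_nonneg (by rw [sub_nonneg]; exact_mod_cast h)]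
    congr 1
    have : ((n - m).toNat : ℤ) = n - m := by omega
    exact_mod_cast this
  · have := key n (m - n).toNat
    rw [show n + ((m - n).toNat : ℤ) = m by omega, dist_comm] at this
    refine this.trans_eq ?_
    rw [abs_of_nonneg (by rw [sub_nonneg]; exact_mod_cast h)]
    congr 1
    have : ((m - n).toNat : ℤ) = m - n := by omega
    exact_mod_cast this

end OrbitBounds

/-! ### The invariant line through an orbit. -/

section OrbitLine

variable {G : Type*} [Group G] {X : Type*} [MetricSpace X] [MulAction G X]

/-- The bi-infinite path obtained by concatenating the translates of a geodesic `σ` from `o` to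
`g • o`. -/
noncomputable def orbitLine (g : G) (o : X) (σ : ℝ → X) (t : ℝ) : X :=
  g ^ ⌊t⌋ • σ (Int.fract t * dist o (g • o))

variable {g : G} {o : X} {σ : ℝ → X}

theorem orbitLine_add_one (t : ℝ) : orbitLine g o σ (t + 1) = g • orbitLine g o σ t := by
  rw [orbitLine, orbitLine, Int.floor_add_one, Int.fract_add_one, smul_smul, ← zpow_one_add,
    add_comm]

theorem smul_image_range_orbitLine :
    (fun x => g • x) '' Set.range (orbitLine g o σ) = Set.range (orbitLine g o σ) := by
  ext p
  constructor
  · rintro ⟨_, ⟨t, rfl⟩, rfl⟩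
    exact ⟨t + 1, orbitLine_add_one t⟩
  · rintro ⟨t, rfl⟩
    exact ⟨_, ⟨t - 1, rfl⟩, by
      change g • orbitLine g o σ (t - 1) = _
      rw [← orbitLine_add_one, sub_add_cancel]⟩

theorem orbitLine_intCast (hσ : IsGeodesicFromTo σ o (g • o)) (n : ℤ) :
    orbitLine g o σ n = g ^ n • o := by
  rw [orbitLine, Int.floor_intCast, Int.fract_intCast, zero_mul, hσ.2.1]

end OrbitLine

/-! ### From loxodromic on the contraction space to strongly contracting on `X`. -/

section OrbitAxis

variable {G : Type*} [Group G] {X : Type*} [MetricSpace X] [MulAction G X] [IsIsometricSMul G X]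
  {K : ℝ≥0 → ℝ≥0∞}

theorem IsCoarseLine.contractionDist_le {C : ℕ} {x : ℤ → X} (hX : IsGeodesicSpace X)
    (hx : IsCoarseLine K C x) (i j : ℤ) :
    contractionDist K (x i) (x j) ≤ C * (i - j).natAbs := by
  obtain ⟨p, hp, -⟩ := hx.exists_walk_between hX (i := min i j) (j := max i j)
    ⟨min_le_left i j, le_max_left i j⟩ ⟨min_le_right i j, le_max_right i j⟩
  exact (SimpleGraph.dist_le p).trans hp

/-- An orbit of a cyclic group that is quasi-isometrically embedded in the contraction graph is
a thin axis. -/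
theorem exists_isThinAxis (hX : IsGeodesicSpace X) (hK : IsContractionGauge K) (g : G) (o : X)
    {C : ℕ} (hx : IsCoarseLine K C fun n : ℤ => g ^ n • o) :
    ∃ (m : ℤ → X) (α β : ℤ) (H r : ℕ) (B : ℝ),
      IsThinAxis K (fun n : ℤ => g ^ n • o) m α β H r B := by
  obtain ⟨H, hH⟩ := hx.exists_close hX hK
  obtain ⟨r, hr⟩ := hx.exists_isThinPoint hX hK ⌈dist o (g • o)⌉₊ (fun n => by
    refine (dist_zpow_smul_le g o 0 n).trans ?_
    push_cast
    rw [zero_sub, abs_neg, Nat.abs_cast]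
    gcongr
    exact Nat.le_ceil _)
  set F := 2 * r + H + 1 with hF
  -- The distance required here ensures that orbit points within `F` of `p` have index strictly
  -- closer to `s` than both `0` and `n`.
  obtain ⟨n, p, hp, hp0, hpn⟩ := hr (H + C * (C * (F + H) + C) + 1)
  obtain ⟨A, hA, hpA, -⟩ := id hp
  obtain ⟨s, hs, hps⟩ := hH 0 n (by omega) A hA p hpA
  have htr : ∀ k l : ℤ, contractionDist K (g ^ (k - s) • p) (g ^ l • o) =
      contractionDist K p (g ^ (l - k + s) • o) := by
    intro k l
    rw [← contractionDist_smul (g ^ (k - s)) p, smul_smul, ← zpow_add]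
    congr 3; ring
  have hfar : ∀ e l : ℤ, H + C * (C * (F + H) + C) + 1 ≤ contractionDist K p (g ^ e • o) →
      (e - s).natAbs ≤ (s - l).natAbs → F < contractionDist K p (g ^ l • o) := by
    intro e l he hle
    by_contra! hlt
    have h1 := hX.contractionDist_triangle (K := K) p (g ^ s • o) (g ^ e • o)
    have h2 : contractionDist K (g ^ s • o) (g ^ e • o) ≤ C * (s - e).natAbs :=
      hx.contractionDist_le hX s e
    have h3 := hX.contractionDist_triangle (K := K) (g ^ s • o) p (g ^ l • o)
    rw [contractionDist_comm _ p] at h3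
    have h4 : (s - l).natAbs ≤ C * contractionDist K (g ^ s • o) (g ^ l • o) + C := hx.spread s l
    have h5 : C * contractionDist K (g ^ s • o) (g ^ l • o) ≤ C * (F + H) :=
      Nat.mul_le_mul_left _ (by omega)
    have h6 : C * (s - e).natAbs ≤ C * (C * (F + H) + C) := Nat.mul_le_mul_left _ (by omega)
    omega
  refine ⟨fun k => g ^ (k - s) • p, s, n - s, H, r, dist p (g ^ s • o), ⟨hs.1, ?_, hH, ?_, ?_, ?_,
    ?_⟩⟩
  · have := hs.2; omega
  · intro k
    have := hp.smul (g ^ (k - s))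
    simp only [smul_smul, ← zpow_add] at this
    rwa [show k - s + 0 = k - s by ring, show k - s + (n : ℤ) = k + (n - s) by ring] at this
  · intro k
    rw [htr, sub_self, zero_add]
    exact hps
  · intro k
    rw [← dist_smul (g ^ (k - s)) p, smul_smul, ← zpow_add, sub_add_cancel]
  · rintro k l (hl | hl)
    · rw [htr]
      exact hfar 0 _ hp0 (by have := hs.1; omega)
    · rw [htr]
      exact hfar n _ hpn (by have := hs.2; omega)

variable {g : G} {o : X} {σ : ℝ → X}

theorem fract_mul_mem (t d : ℝ) (hd : 0 ≤ d) : Int.fract t * d ∈ Set.Icc 0 d :=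
  ⟨mul_nonneg (Int.fract_nonneg t) hd,
    mul_le_of_le_one_left hd (Int.fract_lt_one t).le⟩

theorem dist_orbitLine_floor (hσ : IsGeodesicFromTo σ o (g • o)) (t : ℝ) :
    dist (orbitLine g o σ t) (g ^ ⌊t⌋ • o) = Int.fract t * dist o (g • o) := by
  have hm := fract_mul_mem t (dist o (g • o)) dist_nonneg
  have := hσ.1.dist_eq le_rfl hm.1 hm.2
  rw [hσ.2.1, sub_zero] at this
  rw [orbitLine, dist_smul, dist_comm, this]

theorem dist_orbitLine_floor_add_one (hσ : IsGeodesicFromTo σ o (g • o)) (t : ℝ) :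
    dist (orbitLine g o σ t) (g ^ (⌊t⌋ + 1) • o) = (1 - Int.fract t) * dist o (g • o) := by
  have hm := fract_mul_mem t (dist o (g • o)) dist_nonneg
  have := hσ.1.dist_eq hm.1 hm.2 le_rfl
  rw [hσ.2.2] at this
  rw [orbitLine, zpow_add_one, mul_smul, dist_smul, this]
  ring

theorem dist_orbitLine_le (hσ : IsGeodesicFromTo σ o (g • o)) (t : ℝ) :
    dist (orbitLine g o σ t) (g ^ ⌊t⌋ • o) ≤ dist o (g • o) := by
  rw [dist_orbitLine_floor hσ]
  exact (fract_mul_mem t _ dist_nonneg).2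

theorem continuous_orbitLine (hσ : IsGeodesicFromTo σ o (g • o)) :
    Continuous (orbitLine g o σ) := by
  have key : ∀ s t : ℝ, s ≤ t → t - s < 1 →
      dist (orbitLine g o σ s) (orbitLine g o σ t) ≤ dist o (g • o) * (t - s) := by
    intro s t hst hlt
    have hs := Int.floor_add_fract s
    have ht := Int.floor_add_fract t
    rcases (Int.floor_mono hst).eq_or_lt with h | h
    · have hms := fract_mul_mem s (dist o (g • o)) dist_nonneg
      have hmt := fract_mul_mem t (dist o (g • o)) dist_nonneg
      rw [orbitLine, orbitLine, ← h, dist_smul, hσ.1.2 _ hms _ hmt, ← sub_mul, abs_mul,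
        abs_of_nonneg (dist_nonneg (x := o) (y := g • o)), mul_comm]
      gcongr
      rw [← h] at ht
      rw [abs_sub_comm, abs_le]
      constructor <;> linarith
    · have h1 : ⌊t⌋ = ⌊s⌋ + 1 := by
        have : ⌊t⌋ < ⌊s⌋ + 2 := by
          rw [Int.floor_lt]
          push_cast
          linarith [Int.lt_floor_add_one s]
        omega
      have h2 := dist_orbitLine_floor_add_one hσ s
      have h3 := dist_orbitLine_floor hσ t
      rw [h1] at h3 ht
      push_cast at ht
      refine (dist_triangle_right _ _ (g ^ (⌊s⌋ + 1) • o)).trans ?_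
      rw [h2, h3]
      refine le_of_eq ?_
      rw [show t - s = (1 - Int.fract s) + Int.fract t by linarith]
      ring
  have key' : ∀ s t : ℝ, |t - s| < 1 →
      dist (orbitLine g o σ s) (orbitLine g o σ t) ≤ dist o (g • o) * |t - s| := by
    intro s t hlt
    rcases le_total s t with h | h
    · rw [abs_of_nonneg (by linarith)] at hlt ⊢
      exact key s t h hlt
    · rw [abs_sub_comm, abs_of_nonneg (by linarith)] at hlt ⊢
      rw [dist_comm]
      exact key t s h hlt
  rw [continuous_iff_continuousAt]
  intro s
  rw [ContinuousAt, tendsto_iff_dist_tendsto_zero]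
  have hlim : Filter.Tendsto (fun t : ℝ => dist o (g • o) * |t - s|) (nhds s) (nhds 0) := by
    have : Continuous fun t : ℝ => dist o (g • o) * |t - s| := by fun_prop
    simpa using this.tendsto s
  refine squeeze_zero' (Filter.Eventually.of_forall fun _ => dist_nonneg) ?_ hlim
  filter_upwards [Metric.ball_mem_nhds s one_pos] with t ht
  rw [dist_comm]
  exact key' s t (by rwa [Metric.mem_ball, Real.dist_eq] at ht)

theorem isQuasiGeodesicLine_orbitLine (hσ : IsGeodesicFromTo σ o (g • o)) {C C' : ℝ} (hC : 1 ≤ C)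
    (h : ∀ m n : ℤ, |(m : ℝ) - n| / C - C ≤ dist (g ^ m • o) (g ^ n • o) ∧
      dist (g ^ m • o) (g ^ n • o) ≤ C * |(m : ℝ) - n| + C)
    (hC' : 2 * C + 2 * dist o (g • o) + 1 ≤ C') :
    IsQuasiGeodesicLine C' (orbitLine g o σ) := by
  have hd := dist_nonneg (x := o) (y := g • o)
  refine ⟨by linarith, continuous_orbitLine hσ, fun s t => ?_⟩
  obtain ⟨h1, h2⟩ := h ⌊s⌋ ⌊t⌋
  have hs := dist_orbitLine_le hσ s
  have ht := dist_orbitLine_le hσ t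
  have t1 := dist_triangle4 (orbitLine g o σ s) (g ^ ⌊s⌋ • o) (g ^ ⌊t⌋ • o) (orbitLine g o σ t)
  have t2 := dist_triangle4 (g ^ ⌊s⌋ • o) (orbitLine g o σ s) (orbitLine g o σ t) (g ^ ⌊t⌋ • o)
  rw [dist_comm (g ^ ⌊t⌋ • o) (orbitLine g o σ t)] at t1
  rw [dist_comm (g ^ ⌊s⌋ • o) (orbitLine g o σ s)] at t2
  have e : |(|(⌊s⌋ : ℝ) - ⌊t⌋| - |t - s|)| ≤ 1 := by
    rw [abs_sub_comm t s]
    refine (abs_abs_sub_abs_le _ _).trans ?_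
    have hs1 := Int.floor_le s
    have hs2 := Int.lt_floor_add_one s
    have ht1 := Int.floor_le t
    have ht2 := Int.lt_floor_add_one t
    rw [abs_le]
    constructor <;> linarith
  rw [abs_le] at e
  have e1 : |t - s| / C' ≤ |t - s| / C :=
    div_le_div_of_nonneg_left (abs_nonneg _) (by linarith) (by linarith)
  have e2 : |t - s| / C ≤ |(⌊s⌋ : ℝ) - ⌊t⌋| / C + 1 := by
    rw [div_le_iff₀ (by linarith), add_mul, div_mul_cancel₀ _ (by linarith)]
    linarith
  have e3 : C * |(⌊s⌋ : ℝ) - ⌊t⌋| ≤ C * (|t - s| + 1) :=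
    mul_le_mul_of_nonneg_left (by linarith) (by linarith)
  have e4 : C * |t - s| ≤ C' * |t - s| :=
    mul_le_mul_of_nonneg_right (by linarith) (abs_nonneg _)
  constructor <;> linarith

theorem isContracting_orbitLine (hX : IsGeodesicSpace X) (hK : IsContractionGauge K)
    (hσ : IsGeodesicFromTo σ o (g • o)) {m : ℤ → X} {α β : ℤ} {H r : ℕ} {B C : ℝ} (hC : 1 ≤ C)
    (hx : IsThinAxis K (fun n : ℤ => g ^ n • o) m α β H r B)
    (hlow : ∀ m n : ℤ, |(m : ℝ) - n| / C - C ≤ dist (g ^ m • o) (g ^ n • o)) :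
    ∃ D, IsContracting D (Set.range (orbitLine g o σ)) := by
  set d := dist o (g • o) with hd
  set S := Set.range (orbitLine g o σ) with hS
  have hd0 : 0 ≤ d := dist_nonneg
  -- `d` pays for replacing a point of the line by an orbit point, `1` for the centre `x`, for which
  -- only an almost closest point is chosen.
  set c := d + 1 with hc
  obtain ⟨M, hM⟩ : ∃ M : ℕ, ∀ i j : ℤ, M ≤ (i - j).natAbs →
      4 * (r + B) + c < dist (g ^ i • o) (g ^ j • o) := by
    refine ⟨⌈C * (4 * (r + B) + c + 1 + C)⌉₊, fun i j hij => ?_⟩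
    have h1 : C * (4 * (r + B) + c + 1 + C) ≤ |(i : ℝ) - j| := by
      refine (Nat.le_ceil _).trans ((Nat.cast_le.2 hij).trans_eq ?_)
      rw [Nat.cast_natAbs]
      push_cast
      rfl
    have h2 : 4 * (r + B) + c + 1 + C ≤ |(i : ℝ) - j| / C := by
      rw [le_div_iff₀ (by linarith), mul_comm]
      exact h1
    linarith [hlow i j]
  have hinf : ∀ (y : X) (j : ℤ), Metric.infDist y S ≤ dist y (g ^ j • o) := fun y j =>
    Metric.infDist_le_dist_of_mem ⟨j, orbitLine_intCast hσ j⟩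
  have hnear : ∀ (y : X) (t : ℝ), dist y (orbitLine g o σ t) ≤ Metric.infDist y S + 1 →
      ∀ j : ℤ, dist y (g ^ ⌊t⌋ • o) ≤ dist y (g ^ j • o) + c := by
    intro y t ht j
    have h1 := dist_triangle y (orbitLine g o σ t) (g ^ ⌊t⌋ • o)
    have h2 := dist_orbitLine_le hσ t
    have h3 := hinf y j
    linarith
  refine ⟨2 * d + d * (2 * (2 * M + 3 * α + 3 * β)), fun x y hy z hz p hp q hq => ?_⟩
  obtain ⟨_, ⟨u, rfl⟩, hu⟩ := (Metric.infDist_lt_iff (s := S) (x := x)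
    (r := Metric.infDist x S + 1) ⟨_, 0, rfl⟩).1 (by linarith)
  obtain ⟨⟨s, rfl⟩, hs⟩ := hp
  obtain ⟨⟨t, rfl⟩, ht⟩ := hq
  rw [Metric.mem_ball, dist_comm] at hy hz
  have hxu := hnear x u hu.le
  have h1 := hx.natAbs_sub_lt_of_dist_lt hX hK hM hxu (hnear y s (by linarith))
    (fun j => hy.trans_le (hinf x j))
  have h2 := hx.natAbs_sub_lt_of_dist_lt hX hK hM hxu (hnear z t (by linarith))
    (fun j => hz.trans_le (hinf x j))
  have h3 : |⌊s⌋ - ⌊t⌋| ≤ 2 * (2 * M + 3 * α + 3 * β) := by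
    rw [abs_lt] at h1 h2
    rw [abs_le]
    constructor <;> linarith
  have h4 : |(⌊s⌋ : ℝ) - ⌊t⌋| ≤ 2 * (2 * M + 3 * α + 3 * β) := by exact_mod_cast h3
  have h5 := dist_zpow_smul_le g o ⌊s⌋ ⌊t⌋
  have h6 := dist_triangle4 (orbitLine g o σ s) (g ^ ⌊s⌋ • o) (g ^ ⌊t⌋ • o) (orbitLine g o σ t)
  rw [dist_comm (g ^ ⌊t⌋ • o) (orbitLine g o σ t)] at h6
  have h7 := dist_orbitLine_le hσ s
  have h8 := dist_orbitLine_le hσ t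
  have h9 := mul_le_mul_of_nonneg_left h4 hd0
  linarith

theorem IsContracting.mono {D D' : ℝ} {S : Set X} (h : IsContracting D S) (hD : D ≤ D') :
    IsContracting D' S := fun x y hy z hz p hp q hq => (h x y hy z hz p hp q hq).trans hD

instance ContractionSpace.instIsIsometricSMul : IsIsometricSMul G (ContractionSpace K X) where
  isometry_smul c := Isometry.of_dist_eq fun a b => by
    obtain ⟨a, rfl⟩ := SeparationQuotient.surjective_mk a
    obtain ⟨b, rfl⟩ := SeparationQuotient.surjective_mk b
    rw [← SeparationQuotient.mk_smul, ← SeparationQuotient.mk_smul, SeparationQuotient.dist_mk,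
      SeparationQuotient.dist_mk, dist_smul]

theorem isStronglyContracting_of_isLoxodromic (hX : IsGeodesicSpace X) (hK : IsContractionGauge K)
    (h : IsLoxodromic (ContractionSpace K X) g) : IsStronglyContracting X g := by
  obtain ⟨o⟩ : Nonempty X := by
    obtain ⟨y, -⟩ := h
    obtain ⟨a, rfl⟩ := SeparationQuotient.surjective_mk y
    exact ⟨(PreContractionSpace.Walk.exists_to_point a).choose⟩
  obtain ⟨C, hC, hb⟩ := h.exists_bound (SeparationQuotient.mk (PreContractionSpace.point o))
  have hpt : ∀ n : ℤ, g ^ n • (SeparationQuotient.mk (PreContractionSpace.point o) :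
      ContractionSpace K X) = SeparationQuotient.mk (PreContractionSpace.point (g ^ n • o)) :=
    fun n => rfl
  simp only [hpt, SeparationQuotient.dist_mk] at hb
  have hlow : ∀ m n : ℤ, |(m : ℝ) - n| / C - C ≤ dist (g ^ m • o) (g ^ n • o) := fun m n =>
    (hb m n).1.trans (PreContractionSpace.dist_point_le _ _)
  obtain ⟨C₀, hC₀⟩ : ∃ C₀ : ℕ, IsCoarseLine K C₀ fun n : ℤ => g ^ n • o := by
    -- Clearing the denominator in the lower bound gives `|i - j| ≤ C * dist + C ^ 2`, whence the `C
    -- ^ 2`.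
    refine ⟨max (contractionDist K o (g • o)) ⌈C ^ 2⌉₊, ⟨fun n => ?_, fun i j => ?_⟩⟩
    · rw [zpow_add_one, mul_smul, contractionDist_smul]
      exact le_max_left _ _
    · have h1 := (hb i j).1.trans (PreContractionSpace.dist_point_le_contractionDist hX _ _)
      rw [sub_le_iff_le_add, div_le_iff₀ (by linarith)] at h1
      have h2 : C ^ 2 ≤ (max (contractionDist K o (g • o)) ⌈C ^ 2⌉₊ : ℕ) :=
        (Nat.le_ceil _).trans (Nat.cast_le.2 (le_max_right _ _))
      have h3 : C ≤ C ^ 2 := by nlinarith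
      have h4 : ((i - j).natAbs : ℝ) = |(i : ℝ) - j| := by
        rw [Nat.cast_natAbs]; push_cast; rfl
      rw [← Nat.cast_le (α := ℝ)]
      push_cast [h4] at h2 ⊢
      have h5 : (0 : ℝ) ≤ contractionDist K (g ^ i • o) (g ^ j • o) := Nat.cast_nonneg _
      nlinarith
  obtain ⟨m, α, β, H, r, B, hax⟩ := exists_isThinAxis hX hK g o hC₀
  obtain ⟨σ, hσ⟩ := hX o (g • o)
  obtain ⟨D, hD⟩ := isContracting_orbitLine hX hK hσ hC hax hlow
  set E := C + dist o (g • o) with hE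
  have hd := dist_nonneg (x := o) (y := g • o)
  have hqi : ∀ m n : ℤ, |(m : ℝ) - n| / E - E ≤ dist (g ^ m • o) (g ^ n • o) ∧
      dist (g ^ m • o) (g ^ n • o) ≤ E * |(m : ℝ) - n| + E := by
    intro m n
    have h1 : |(m : ℝ) - n| / E ≤ |(m : ℝ) - n| / C :=
      div_le_div_of_nonneg_left (abs_nonneg _) (by linarith) (by linarith)
    have h2 := dist_zpow_smul_le g o m n
    have h3 := hlow m n
    have h4 : 0 ≤ C * |(m : ℝ) - n| := by positivity
    constructor
    · linarith
    · rw [hE, add_mul]; linarith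
  refine ⟨⟨o, E, by linarith, hqi⟩, max D (2 * E + 2 * dist o (g • o) + 1), orbitLine g o σ,
    isQuasiGeodesicLine_orbitLine hσ (by linarith) hqi (le_max_right _ _),
    hD.mono (le_max_left _ _), smul_image_range_orbitLine⟩

end OrbitAxis

/-! ### Projection to a contracting quasi-geodesic, and thinness of geodesics following it. -/

section ClosestPointProjection

variable {X : Type*} [MetricSpace X]

/-- `φ` is a parametrised closest point projection to the contracting quasi-geodesic `γ`. -/
structure IsClosestParam (C : ℝ) (γ : ℝ → X) (φ : X → ℝ) : Prop where
  one_le : 1 ≤ C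
  le_dist : ∀ s t, |t - s| / C - C ≤ dist (γ s) (γ t)
  dist_le : ∀ s t, dist (γ s) (γ t) ≤ C * |t - s| + C
  contracting : IsContracting C (Set.range γ)
  closest : ∀ x, γ (φ x) ∈ closestPoints (Set.range γ) x

/-- Closest points exist without properness of `X`: the distance from `x` to `γ t` is continuous in
`t` and tends to infinity with `|t|`. -/
theorem IsQuasiGeodesicLine.exists_isClosestParam {C : ℝ} {γ : ℝ → X}
    (h : IsQuasiGeodesicLine C γ) (hc : IsContracting C (Set.range γ)) :
    ∃ φ : X → ℝ, IsClosestParam C γ φ := by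
  obtain ⟨hC, hcont, hq⟩ := h
  have hex : ∀ x : X, ∃ t : ℝ, ∀ s : ℝ, dist x (γ t) ≤ dist x (γ s) := by
    intro x
    refine Continuous.exists_forall_le (by fun_prop) ?_
    refine Filter.tendsto_atTop_mono (f := fun t : ℝ => ‖t‖ / C - (C + dist x (γ 0))) (fun t => ?_) ?_
    · have h1 := (hq 0 t).1
      have h2 := dist_triangle_left (γ 0) (γ t) x
      rw [sub_zero] at h1
      rw [Real.norm_eq_abs]
      linarith
    · exact Filter.tendsto_atTop_add_const_right _ _
        ((tendsto_norm_cocompact_atTop (E := ℝ)).atTop_div_const (by linarith))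
  choose φ hφ using hex
  refine ⟨φ, hC, fun s t => (hq s t).1, fun s t => (hq s t).2, hc, fun x => ⟨⟨_, rfl⟩, ?_⟩⟩
  refine le_antisymm ?_ (Metric.infDist_le_dist_of_mem ⟨_, rfl⟩)
  refine (Metric.le_infDist (Set.range_nonempty γ)).2 ?_
  rintro _ ⟨s, rfl⟩
  exact hφ x s

namespace IsClosestParam

variable {C : ℝ} {γ : ℝ → X} {φ : X → ℝ}

theorem dist_le_of_lt (h : IsClosestParam C γ φ) {x y : X}
    (hxy : dist x y < Metric.infDist x (Set.range γ)) : dist (γ (φ x)) (γ (φ y)) ≤ C :=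
  h.contracting x x (Metric.mem_ball_self (dist_nonneg.trans_lt hxy)) y
    (by rwa [Metric.mem_ball, dist_comm]) _ (h.closest x) _ (h.closest y)

/-- Contraction covers the case where `y` is closer to `x` than the axis is; otherwise `x` is within
`d(x, y)` of the axis and `y` within `2 d(x, y)`. -/
theorem dist_proj_le (h : IsClosestParam C γ φ) (x y : X) :
    dist (γ (φ x)) (γ (φ y)) ≤ 4 * dist x y + C := by
  rcases lt_or_ge (dist x y) (Metric.infDist x (Set.range γ)) with hlt | hge
  · linarith [h.dist_le_of_lt hlt, dist_nonneg (x := x) (y := y)]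
  · have h1 := (h.closest x).2
    have h2 := (h.closest y).2
    have h3 := Metric.infDist_le_infDist_add_dist (s := Set.range γ) (x := y) (y := x)
    have h4 := dist_triangle4 (γ (φ x)) x y (γ (φ y))
    rw [dist_comm (γ (φ x)) x] at h4
    rw [dist_comm y x] at h3
    linarith [h.one_le]

theorem abs_sub_le_mul (h : IsClosestParam C γ φ) (s t : ℝ) :
    |t - s| ≤ C * (dist (γ s) (γ t) + C) := by
  have hC := h.one_le
  have := h.le_dist s t
  rw [sub_le_iff_le_add, div_le_iff₀ (by linarith)] at this
  linarith

theorem abs_param_sub_le (h : IsClosestParam C γ φ) (x y : X) :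
    |φ x - φ y| ≤ 4 * C * dist x y + 2 * C ^ 2 := by
  have hC := h.one_le
  rw [abs_sub_comm]
  refine (h.abs_sub_le_mul _ _).trans ?_
  nlinarith [h.dist_proj_le x y]

theorem abs_param_self_sub_le (h : IsClosestParam C γ φ) (s : ℝ) : |φ (γ s) - s| ≤ C ^ 2 := by
  have h1 := (h.closest (γ s)).2
  rw [Metric.infDist_zero_of_mem (Set.mem_range_self s)] at h1
  have h2 := h.abs_sub_le_mul s (φ (γ s))
  rw [h1] at h2
  linarith

/-- The projection of a geodesic staying away from a contracting set is coarsely contracted by a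
factor two. -/
theorem dist_proj_le_half (h : IsClosestParam C γ φ) {σ : ℝ → X} {a b : ℝ}
    (hσ : IsGeodesicOn σ a b)
    (hfar : ∀ t ∈ Set.Icc a b, 4 * C ≤ Metric.infDist (σ t) (Set.range γ)) :
    dist (γ (φ (σ a))) (γ (φ (σ b))) ≤ (b - a) / 2 + C := by
  have hC := h.one_le
  -- A step of length `2C` stays inside a ball disjoint from the axis, of radius at least `4C`, so
  -- it moves the projection by at most `C`.
  have key : ∀ (n : ℕ) (t : ℝ), t ∈ Set.Icc a b → t - a ≤ 2 * C * n →
      dist (γ (φ (σ a))) (γ (φ (σ t))) ≤ C * n := by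
    intro n
    induction n with
    | zero =>
      intro t ht hle
      have : t = a := le_antisymm (by simpa using hle) ht.1
      simp [this]
    | succ n ih =>
      intro t ht hle
      push_cast at hle ⊢
      have hn : (0 : ℝ) ≤ n := Nat.cast_nonneg n
      have hm : max a (t - 2 * C) ∈ Set.Icc a b :=
        ⟨le_max_left _ _, max_le hσ.1 (by linarith [ht.2])⟩
      have hmt : max a (t - 2 * C) ≤ t := max_le ht.1 (by linarith)
      have h1 := ih _ hm (by
        rw [sub_le_iff_le_add]
        exact max_le (by linarith [mul_nonneg (by linarith : 0 ≤ 2 * C) hn]) (by linarith))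
      have h2 := h.dist_le_of_lt (x := σ (max a (t - 2 * C))) (y := σ t) (by
        rw [hσ.dist_eq hm.1 hmt ht.2]
        have := hfar _ hm
        have := le_max_right a (t - 2 * C)
        linarith)
      have h3 := dist_triangle (γ (φ (σ a))) (γ (φ (σ (max a (t - 2 * C))))) (γ (φ (σ t)))
      linarith
  have h0 : 0 ≤ (b - a) / (2 * C) := div_nonneg (by linarith [hσ.1]) (by linarith)
  have h1 := key ⌈(b - a) / (2 * C)⌉₊ b ⟨hσ.1, le_rfl⟩ (by
    have := Nat.le_ceil ((b - a) / (2 * C))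
    rwa [div_le_iff₀ (by linarith), mul_comm] at this)
  have h2 := mul_le_mul_of_nonneg_left (Nat.ceil_lt_add_one h0).le (by linarith : 0 ≤ C)
  have h3 : C * ((b - a) / (2 * C) + 1) = (b - a) / 2 + C := by field_simp
  linarith

/-- The projection of a geodesic staying away from a contracting set is bounded. -/
theorem dist_proj_le_of_far (h : IsClosestParam C γ φ) {σ : ℝ → X} {a b : ℝ}
    (hσ : IsGeodesicOn σ a b)
    (hfar : ∀ t ∈ Set.Icc a b, 4 * C ≤ Metric.infDist (σ t) (Set.range γ)) :
    dist (γ (φ (σ a))) (γ (φ (σ b))) ≤ 10 * C := by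
  have hC := h.one_le
  have ha := hfar a ⟨le_rfl, hσ.1⟩
  have hb := hfar b ⟨hσ.1, le_rfl⟩
  set dx := Metric.infDist (σ a) (Set.range γ) with hdx
  set dy := Metric.infDist (σ b) (Set.range γ) with hdy
  have hd := hσ.dist_eq le_rfl hσ.1 le_rfl
  rcases lt_or_ge (b - a) dx with h1 | h1
  · linarith [h.dist_le_of_lt (x := σ a) (y := σ b) (by linarith)]
  rcases lt_or_ge (b - a) dy with h2 | h2
  · rw [dist_comm]
    linarith [h.dist_le_of_lt (x := σ b) (y := σ a) (by rw [dist_comm]; linarith)]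
  have hp := h.dist_le_of_lt (x := σ a) (y := σ (a + dx - 2 * C)) (by
    rw [hσ.dist_eq le_rfl (by linarith) (by linarith)]; linarith)
  have hright : ∀ t, b - dy + 2 * C ≤ t → t ≤ b → dist (γ (φ (σ b))) (γ (φ (σ t))) ≤ C :=
    fun t h3 h4 => h.dist_le_of_lt (by
      rw [dist_comm, hσ.dist_eq (by linarith) h4 le_rfl]; linarith)
  -- Let `P` be the distance between the projections. Both end pieces contribute at most `C`, and `b
  -- - a ≤ dx + dy + P`, so the middle piece has length at most `P + 4C`. Thus `P ≤ 2C + (P + 4C) /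
  -- 2 + C`, that is `P ≤ 10C`.
  rcases le_total (a + dx - 2 * C) (b - dy + 2 * C) with h3 | h3
  · have h4 := h.dist_proj_le_half (hσ.mono (by linarith) h3 (by linarith))
      (fun t ht => hfar t ⟨by linarith [ht.1], by linarith [ht.2]⟩)
    have h5 := hright _ le_rfl (by linarith)
    have h6 := dist_triangle4 (γ (φ (σ a))) (γ (φ (σ (a + dx - 2 * C))))
      (γ (φ (σ (b - dy + 2 * C)))) (γ (φ (σ b)))
    have h7 := dist_triangle4 (σ a) (γ (φ (σ a))) (γ (φ (σ b))) (σ b)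
    rw [dist_comm (γ (φ (σ b))) (σ b), (h.closest (σ a)).2, (h.closest (σ b)).2] at h7
    rw [dist_comm (γ (φ (σ (b - dy + 2 * C)))) (γ (φ (σ b)))] at h6
    linarith
  · have h4 := hright _ h3 (by linarith)
    have h5 := dist_triangle_right (γ (φ (σ a))) (γ (φ (σ b))) (γ (φ (σ (a + dx - 2 * C))))
    linarith

end IsClosestParam

/-- `ψ` is a Lipschitz map to `ℝ`, coarsely a retraction to the path `γ`, such that geodesics
along which `ψ` varies enough pass near `γ`. -/
structure IsTracking (A : ℝ) (γ : ℝ → X) (ψ : X → ℝ) : Prop where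
  one_le : 1 ≤ A
  lip : ∀ x y, |ψ x - ψ y| ≤ A * dist x y
  param : ∀ s, |ψ (γ s) - s| ≤ A
  dist_le : ∀ s t, dist (γ s) (γ t) ≤ A * |t - s| + A
  pass : ∀ (σ : ℝ → X) (a b : ℝ), IsGeodesicOn σ a b → A < |ψ (σ a) - ψ (σ b)| →
    ∃ t ∈ Set.Icc a b, dist (σ t) (γ (ψ (σ t))) ≤ A

/-- The infimal convolution of `φ` with `4C` times the distance is truly Lipschitz and within `2C²`
of `φ`; continuity is needed for intermediate values. A geodesic far from `γ` has end projections at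
most `10C` apart, so `φ` differs by at most `11C²` at its ends and `ψ` by at most `15C²`, hence the
constant. -/
theorem IsClosestParam.exists_isTracking {C : ℝ} {γ : ℝ → X} {φ : X → ℝ}
    (h : IsClosestParam C γ φ) : ∃ ψ : X → ℝ, IsTracking (15 * C ^ 3) γ ψ := by
  have hC := h.one_le
  have hC2 : C ≤ C ^ 2 := by nlinarith
  have hC3 : C ^ 2 ≤ C ^ 3 := by nlinarith [sq_nonneg C]
  have hle : ∀ x y, φ x - 2 * C ^ 2 ≤ φ y + 4 * C * dist x y := by
    intro x y
    have := (abs_le.1 (h.abs_param_sub_le x y)).2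
    linarith
  have hbdd : ∀ x, BddBelow (Set.range fun y => φ y + 4 * C * dist x y) := fun x =>
    ⟨φ x - 2 * C ^ 2, by rintro _ ⟨y, rfl⟩; exact hle x y⟩
  set ψ : X → ℝ := fun x => ⨅ y, φ y + 4 * C * dist x y with hψ
  have hup : ∀ x, ψ x ≤ φ x := fun x => (ciInf_le (hbdd x) x).trans (by simp)
  have hlow : ∀ x, φ x - 2 * C ^ 2 ≤ ψ x := fun x =>
    have : Nonempty X := ⟨x⟩
    le_ciInf (hle x)
  have hlip : ∀ x y, ψ x ≤ ψ y + 4 * C * dist x y := by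
    intro x y
    have : Nonempty X := ⟨x⟩
    rw [← sub_le_iff_le_add]
    refine le_ciInf fun z => ?_
    have h1 := ciInf_le (hbdd x) z
    have h2 := mul_le_mul_of_nonneg_left (dist_triangle x y z) (by linarith : 0 ≤ 4 * C)
    change ψ x ≤ _ at h1
    linarith
  have hφψ : ∀ x, |ψ x - φ x| ≤ 2 * C ^ 2 := fun x =>
    abs_le.2 ⟨by linarith [hlow x], by linarith [hup x, sq_nonneg C]⟩
  refine ⟨ψ, by linarith, fun x y => ?_, fun s => ?_, fun s t => ?_, fun σ a b hσ hab => ?_⟩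
  · have h1 : 4 * C * dist x y ≤ 15 * C ^ 3 * dist x y :=
      mul_le_mul_of_nonneg_right (by linarith) dist_nonneg
    have h2 := hlip x y
    have h3 := hlip y x
    rw [dist_comm y x] at h3
    exact abs_le.2 ⟨by linarith, by linarith⟩
  · have h1 := h.abs_param_self_sub_le s
    have h2 := abs_sub_le (ψ (γ s)) (φ (γ s)) s
    linarith [hφψ (γ s)]
  · have h1 := h.dist_le s t
    have h2 : C * |t - s| ≤ 15 * C ^ 3 * |t - s| :=
      mul_le_mul_of_nonneg_right (by linarith) (abs_nonneg _)
    linarith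
  · by_contra! hno
    have hfar : ∀ t ∈ Set.Icc a b, 4 * C ≤ Metric.infDist (σ t) (Set.range γ) := by
      intro t ht
      by_contra! hlt
      have h1 := hno t ht
      have h2 := (h.closest (σ t)).2
      have h3 := dist_triangle (σ t) (γ (φ (σ t))) (γ (ψ (σ t)))
      have h4 := h.dist_le (φ (σ t)) (ψ (σ t))
      have h5 := mul_le_mul_of_nonneg_left (hφψ (σ t)) (by linarith : 0 ≤ C)
      nlinarith
    have h1 := h.dist_proj_le_of_far hσ hfar
    have h2 := h.abs_sub_le_mul (φ (σ b)) (φ (σ a))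
    rw [dist_comm] at h2
    have h3 := abs_sub_le (ψ (σ a)) (φ (σ a)) (ψ (σ b))
    have h4 := abs_sub_le (φ (σ a)) (φ (σ b)) (ψ (σ b))
    have h5 := hφψ (σ a)
    have h6 := hφψ (σ b)
    rw [abs_sub_comm] at h6
    have h7 := mul_le_mul_of_nonneg_left h1 (by linarith : 0 ≤ C)
    nlinarith

namespace IsTracking

variable {A : ℝ} {γ : ℝ → X} {ψ : X → ℝ}

theorem reverse (h : IsTracking A γ ψ) : IsTracking A (fun t => γ (-t)) (fun x => -ψ x) where
  one_le := h.one_le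
  lip x y := by rw [← abs_neg]; convert h.lip x y using 2; ring
  param s := by rw [← abs_neg]; convert h.param (-s) using 2; ring
  dist_le s t := by
    convert h.dist_le (-s) (-t) using 3
    rw [← abs_neg]; congr 1; ring
  pass σ a b hσ hab := by
    obtain ⟨t, ht, htd⟩ := h.pass σ a b hσ (by
      rw [← abs_neg] at hab; convert hab using 2; ring)
    exact ⟨t, ht, by simpa using htd⟩

theorem continuous (h : IsTracking A γ ψ) : Continuous ψ :=
  (LipschitzWith.of_dist_le_mul (K := ⟨A, by linarith [h.one_le]⟩) fun x y => by
    rw [Real.dist_eq]; exact h.lip x y).continuous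

theorem abs_sub_le_of_dist_le (h : IsTracking A γ ψ) {x : X} {s c : ℝ} (hx : dist x (γ s) ≤ c) :
    |ψ x - s| ≤ A * c + A := by
  have h1 := h.lip x (γ s)
  have h2 := h.param s
  have h3 := abs_sub_le (ψ x) (ψ (γ s)) s
  have h4 := mul_le_mul_of_nonneg_left hx (by linarith [h.one_le] : 0 ≤ A)
  linarith

/-- Between the last time `u` with `ψ ≤ s - A` and the next time `v` with `ψ ≥ s + A`, the value of
`ψ` stays within `A` of `s` but changes by `2A`, so `pass` applies there. -/
theorem exists_dist_le_of_le (h : IsTracking A γ ψ) {σ : ℝ → X} {a b s : ℝ}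
    (hσ : IsGeodesicOn σ a b) (ha : ψ (σ a) ≤ s - A) (hb : s + A ≤ ψ (σ b)) :
    ∃ t ∈ Set.Icc a b, dist (σ t) (γ s) ≤ A ^ 2 + 2 * A := by
  have hA := h.one_le
  have hc : ContinuousOn (fun t => ψ (σ t)) (Set.Icc a b) :=
    h.continuous.comp_continuousOn hσ.continuousOn
  obtain ⟨u, ⟨hu, hus⟩, humax⟩ := (isCompact_Icc.of_isClosed_subset
    (hc.preimage_isClosed_of_isClosed isClosed_Icc (isClosed_Iic (a := s - A)))
    Set.inter_subset_left).exists_isGreatest ⟨a, ⟨le_rfl, hσ.1⟩, ha⟩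
  have hc' := hc.mono (Set.Icc_subset_Icc_left hu.1)
  obtain ⟨v, ⟨hv, hvs⟩, hvmin⟩ := (isCompact_Icc.of_isClosed_subset
    (hc'.preimage_isClosed_of_isClosed isClosed_Icc (isClosed_Ici (a := s + A)))
    Set.inter_subset_left).exists_isLeast ⟨b, ⟨hu.2, le_rfl⟩, hb⟩
  have hus : ψ (σ u) ≤ s - A := hus
  have hvs : s + A ≤ ψ (σ v) := hvs
  have hmem : ∀ t ∈ Set.Icc u v, t ∈ Set.Icc a b := fun t ht =>
    ⟨hu.1.trans ht.1, ht.2.trans hv.2⟩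
  have hlow : ∀ t ∈ Set.Icc u v, s - A ≤ ψ (σ t) := by
    intro t ht
    by_contra! hlt
    obtain ⟨t', ht', e⟩ := intermediate_value_Icc (hmem t ht).2
      (hc.mono (Set.Icc_subset_Icc_left (hmem t ht).1)) (show s - A ∈ Set.Icc _ _ from
        ⟨hlt.le, by linarith⟩)
    have h1 : t' ≤ u := humax ⟨⟨(hmem t ht).1.trans ht'.1, ht'.2⟩, le_of_eq e⟩
    have h2 : t' = t := le_antisymm (h1.trans ht.1) ht'.1
    subst h2
    exact hlt.ne e
  have hup : ∀ t ∈ Set.Icc u v, ψ (σ t) ≤ s + A := by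
    intro t ht
    by_contra! hlt
    obtain ⟨t', ht', e⟩ := intermediate_value_Icc ht.1
      (hc'.mono (Set.Icc_subset_Icc_right (hmem t ht).2)) (show s + A ∈ Set.Icc _ _ from
        ⟨by linarith, hlt.le⟩)
    have h1 : v ≤ t' := hvmin ⟨⟨ht'.1, ht'.2.trans (hmem t ht).2⟩, le_of_eq e.symm⟩
    have h2 : t' = t := le_antisymm ht'.2 (ht.2.trans h1)
    subst h2
    exact hlt.ne' e
  obtain ⟨t, ht, htd⟩ := h.pass σ u v (hσ.mono hu.1 hv.1 hv.2) (by
    rw [abs_sub_comm]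
    exact lt_of_lt_of_le (by linarith) (le_abs_self _))
  refine ⟨t, hmem t ht, ?_⟩
  have h1 := dist_triangle (σ t) (γ (ψ (σ t))) (γ s)
  have h2 := h.dist_le (ψ (σ t)) s
  have h3 : |s - ψ (σ t)| ≤ A := abs_le.2 ⟨by linarith [hup t ht], by linarith [hlow t ht]⟩
  nlinarith

/-- A geodesic along which `ψ` crosses the value `s` passes near `γ s`. -/
theorem exists_dist_le (h : IsTracking A γ ψ) {σ : ℝ → X} {a b s : ℝ} (hσ : IsGeodesicOn σ a b)
    (hab : ψ (σ a) ≤ s - A ∧ s + A ≤ ψ (σ b) ∨ ψ (σ b) ≤ s - A ∧ s + A ≤ ψ (σ a)) :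
    ∃ t ∈ Set.Icc a b, dist (σ t) (γ s) ≤ A ^ 2 + 2 * A := by
  rcases hab with hab | hab
  · exact h.exists_dist_le_of_le hσ hab.1 hab.2
  · obtain ⟨t, ht, htd⟩ := h.reverse.exists_dist_le_of_le hσ (s := -s) (by linarith)
      (by linarith)
    exact ⟨t, ht, by simpa using htd⟩

/-- `ψ` is coarsely quasi-convex along geodesics. -/
theorem le_of_le_of_le (h : IsTracking A γ ψ) {σ : ℝ → X} {a b t q : ℝ} (hσ : IsGeodesicOn σ a b)
    (ht : t ∈ Set.Icc a b) (ha : ψ (σ a) ≤ q) (hb : ψ (σ b) ≤ q) :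
    ψ (σ t) ≤ q + (3 * A * (A ^ 2 + 2 * A) + 2 * A) := by
  have hA := h.one_le
  by_contra! hlt
  have hpos : 0 ≤ 3 * A * (A ^ 2 + 2 * A) := by positivity
  -- With `T = A ^ 2 + 2 * A`, the geodesic passes `T`-near `γ (q + A)` both before and after `t`.
  -- The excursion has length at most `2T`, so `σ t` is within `3T` of that point.
  obtain ⟨u, hu, hud⟩ := h.exists_dist_le (s := q + A) (hσ.mono le_rfl ht.1 ht.2)
    (Or.inl ⟨by linarith, by linarith⟩)
  obtain ⟨v, hv, hvd⟩ := h.exists_dist_le (s := q + A) (hσ.mono ht.1 ht.2 le_rfl)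
    (Or.inr ⟨by linarith, by linarith⟩)
  have h1 := hσ.dist_eq hu.1 (hu.2.trans hv.1) hv.2
  have h2 := hσ.dist_eq hu.1 hu.2 ht.2
  have h3 := dist_triangle_right (σ u) (σ v) (γ (q + A))
  have h4 := dist_triangle_left (σ t) (γ (q + A)) (σ u)
  have h5 := h.abs_sub_le_of_dist_le (x := σ t) (s := q + A) (c := 3 * (A ^ 2 + 2 * A))
    (by linarith [hv.1])
  have h6 := (abs_le.1 h5).2
  linarith

/-- Quasi-convexity propagates the low value at `a` and the high value at `b` to the ends `c` and
`d` of the whole side. Along the other three sides `ψ` must then return from above `s + 3A` to below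
`s - 3A`. -/
theorem isThin (h : IsTracking A γ ψ) {σ : ℝ → X} {a b s l : ℝ} (hab : a ≤ b)
    (hs : dist (σ ((a + b) / 2)) (γ s) ≤ A ^ 2 + 2 * A)
    (hl : 4 * A * (A ^ 2 + 2 * A) + 6 * A < l)
    (ha : ψ (σ a) ≤ s - l) (hb : s + l ≤ ψ (σ b)) :
    IsThin (2 * (A ^ 2 + 2 * A) + 2 * A ^ 2 + A) σ a b := by
  have hA := h.one_le
  intro γ₁ γ₂ γ₃ γ₄ c d z w hc hd h₁ he h₂ h₃ h₄
  have hmid : (a + b) / 2 ∈ Set.Icc a b := ⟨by linarith, by linarith⟩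
  rw [← he hmid] at hs ⊢
  rw [← he ⟨le_rfl, hab⟩] at ha
  rw [← he ⟨hab, le_rfl⟩] at hb
  have hpos : 0 ≤ A * (A ^ 2 + 2 * A) := by positivity
  have hψ := abs_le.1 (h.abs_sub_le_of_dist_le hs)
  have hψd : s + 3 * A ≤ ψ (γ₁ d) := by
    by_contra! hlt
    have := h.le_of_le_of_le (h₁.mono (hc.trans hmid.1) (hmid.2.trans hd) le_rfl)
      (t := b) (q := s + A * (A ^ 2 + 2 * A) + 3 * A) ⟨hmid.2, hd⟩ (by linarith) (by linarith)
    linarith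
  have hψc : ψ (γ₁ c) ≤ s - 3 * A := by
    by_contra! hlt
    have := h.reverse.le_of_le_of_le (h₁.mono le_rfl (hc.trans hmid.1) (hmid.2.trans hd))
      (t := a) (q := -s + A * (A ^ 2 + 2 * A) + 3 * A) ⟨hc, hmid.1⟩ (by linarith) (by linarith)
    linarith
  have hclose : ∀ (x : X) (p : ℝ), |p - s| ≤ 2 * A → dist x (γ p) ≤ A ^ 2 + 2 * A →
      dist x (γ₁ ((a + b) / 2)) ≤ 2 * (A ^ 2 + 2 * A) + 2 * A ^ 2 + A := by
    intro x p hp hx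
    have h1 := dist_triangle4_right x (γ₁ ((a + b) / 2)) (γ p) (γ s)
    have h2 := h.dist_le s p
    have h3 := mul_le_mul_of_nonneg_left hp (by linarith : 0 ≤ A)
    rw [dist_comm (γ p) (γ s)] at h1
    linarith
  -- The cuts at `s + A` and `s - A` divide the descent so that some side crosses `s + 2A`, `s` or
  -- `s - 2A` with the margin `A` on both sides that `exists_dist_le` requires.
  rcases le_total (ψ z) (s + A) with hz | hz
  · obtain ⟨t, ht, htd⟩ := h.exists_dist_le h₂.1 (s := s + 2 * A) (by
      rw [h₂.2.1, h₂.2.2]; exact Or.inr ⟨by linarith, by linarith⟩)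
    exact ⟨γ₂ t, Or.inl (Or.inl ⟨t, ht, rfl⟩), hclose _ _ (by
      rw [add_sub_cancel_left, abs_of_nonneg (by linarith)]) htd⟩
  rcases le_total (ψ w) (s - A) with hw | hw
  · obtain ⟨t, ht, htd⟩ := h.exists_dist_le h₃.1 (s := s) (by
      rw [h₃.2.1, h₃.2.2]; exact Or.inr ⟨by linarith, by linarith⟩)
    exact ⟨γ₃ t, Or.inl (Or.inr ⟨t, ht, rfl⟩), hclose _ _ (by
      rw [sub_self, abs_zero]; linarith) htd⟩
  · obtain ⟨t, ht, htd⟩ := h.exists_dist_le h₄.1 (s := s - 2 * A) (by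
      rw [h₄.2.1, h₄.2.2]; exact Or.inr ⟨by linarith, by linarith⟩)
    exact ⟨γ₄ t, Or.inr ⟨t, ht, rfl⟩, hclose _ _ (by
      rw [show s - 2 * A - s = -(2 * A) by ring, abs_neg, abs_of_nonneg (by linarith)]) htd⟩

variable {K : ℝ≥0 → ℝ≥0∞}

/-- Along a geodesic, `ψ` increases after a point near `γ s` if it takes a large value at the
endpoint. -/
theorem add_le_of_dist_le (h : IsTracking A γ ψ) {σ : ℝ → X} {u t b s l : ℝ}
    (hσ : IsGeodesicOn σ u b) (hut : u ≤ t) (htb : t ≤ b) (hl : 0 ≤ l)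
    (hs : dist (σ u) (γ s) ≤ A ^ 2 + 2 * A) (hb : s + l + 2 * A ≤ ψ (σ b))
    (htu : 2 * (A ^ 2 + 2 * A) + A * (l + A) + A < t - u) : s + l ≤ ψ (σ t) := by
  have hA := h.one_le
  by_contra! hlt
  obtain ⟨v, hv, hvd⟩ := h.exists_dist_le (s := s + l + A) (hσ.mono hut htb le_rfl)
    (Or.inl ⟨by linarith, by linarith⟩)
  have h1 := hσ.dist_eq le_rfl (hut.trans hv.1) hv.2
  have h2 := dist_triangle4_right (σ u) (σ v) (γ s) (γ (s + l + A))
  have h3 := h.dist_le s (s + l + A)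
  rw [show s + l + A - s = l + A by ring, abs_of_nonneg (by linarith)] at h3
  linarith [hv.1]

/-- A large increase of `ψ` gives a geodesic from `x` to `y` a point `σ u` near the axis at the
middle value `s`. The piece of half-length `c` around it is thin at a scale `r` depending only on
`A`, and `c` is finite yet at least `K r`, against anti-contraction. -/
theorem exists_sub_le (h : IsTracking A γ ψ) (hX : IsGeodesicSpace X)
    (hK : IsFullContractionGauge K) :
    ∃ B, ∀ x y, IsAntiContracting K x y → ψ y - ψ x ≤ B := by
  have hA := h.one_le
  set T := A ^ 2 + 2 * A with hT
  have hT0 : 0 ≤ T := by positivity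
  have hAT : 0 ≤ A * T := by positivity
  set l := 4 * A * T + 6 * A + 1 with hl
  have hl0 : 0 ≤ l := by positivity
  obtain ⟨r, hr⟩ : ∃ r : ℝ≥0, (r : ℝ) = 2 * T + 2 * A ^ 2 + A :=
    ⟨⟨2 * T + 2 * A ^ 2 + A, by positivity⟩, rfl⟩
  set c := 2 * T + A * (l + A) + A + 1 + (K r).toReal with hc
  have hc0 : 0 ≤ c := by positivity
  refine ⟨2 * (A * c + A * T + l + 2 * A), fun x y hxy => ?_⟩
  by_contra! hlt
  have hAc : 0 ≤ A * c := by positivity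
  obtain ⟨σ, hσ⟩ := hX x y
  obtain ⟨s, hs⟩ : ∃ s, s = (ψ x + ψ y) / 2 := ⟨_, rfl⟩
  obtain ⟨u, hu, hud⟩ := h.exists_dist_le hσ.1 (s := s) (by
    rw [hσ.2.1, hσ.2.2]; exact Or.inl ⟨by linarith, by linarith⟩)
  have hψu := abs_le.1 (h.abs_sub_le_of_dist_le hud)
  have d1 := hσ.1.dist_eq le_rfl hu.1 hu.2
  have d2 := hσ.1.dist_eq hu.1 hu.2 le_rfl
  have l1 := abs_le.1 (h.lip (σ 0) (σ u))
  have l2 := abs_le.1 (h.lip (σ u) (σ (dist x y)))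
  rw [d1, hσ.2.1] at l1
  rw [d2, hσ.2.2] at l2
  have hu1 : c ≤ u := by
    by_contra! hlt'
    have := mul_le_mul_of_nonneg_left hlt'.le (by linarith : 0 ≤ A)
    linarith
  have hu2 : c ≤ dist x y - u := by
    by_contra! hlt'
    have := mul_le_mul_of_nonneg_left hlt'.le (by linarith : 0 ≤ A)
    linarith
  have hK0 : 0 ≤ (K r).toReal := ENNReal.toReal_nonneg
  have hAl : 0 ≤ A * (l + A) := by positivity
  have hmid : (u - c + (u + c)) / 2 = u := by ring
  have hright := h.add_le_of_dist_le (hσ.1.mono hu.1 hu.2 le_rfl) (t := u + c) (l := l)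
    (by linarith) (by linarith) hl0 hud (by rw [hσ.2.2]; linarith) (by linarith)
  have hleft : ψ (σ (u - c)) ≤ s - l := by
    have hσ' : IsGeodesicOn (fun t => σ (-t)) (-u) 0 :=
      ⟨by linarith [hu.1], fun p hp q hq => by
        rw [hσ.1.2 _ ⟨by linarith [hp.2], by linarith [hp.1, hu.2]⟩ _
          ⟨by linarith [hq.2], by linarith [hq.1, hu.2]⟩, ← abs_neg]
        congr 1; ring⟩
    have := h.reverse.add_le_of_dist_le hσ' (t := -(u - c)) (s := -s) (l := l)
      (by linarith) (by linarith) hl0 (by simpa using hud) (by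
        simp only [neg_zero]; rw [hσ.2.1]; linarith) (by linarith)
    simp only [neg_neg] at this
    linarith
  refine hxy.2 r σ hσ (u - c) (u + c) (by linarith) (by linarith) (by linarith) ?_ ?_
  · rw [← ENNReal.ofReal_toReal (hK.2 r)]
    exact ENNReal.ofReal_le_ofReal (by linarith)
  · rw [hr]
    exact h.isThin (by linarith) (by rw [hmid]; exact hud) (by linarith) hleft hright

theorem exists_abs_sub_le (h : IsTracking A γ ψ) (hX : IsGeodesicSpace X)
    (hK : IsFullContractionGauge K) :
    ∃ B, ∀ x y, IsAntiContracting K x y → |ψ x - ψ y| ≤ B := by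
  obtain ⟨B, hB⟩ := h.exists_sub_le hX hK
  obtain ⟨B', hB'⟩ := h.reverse.exists_sub_le hX hK
  refine ⟨max B B', fun x y hxy => abs_le.2 ⟨?_, ?_⟩⟩
  · have := (hB x y hxy).trans (le_max_left B B')
    linarith
  · have := (hB' x y hxy).trans (le_max_right B B')
    linarith

end IsTracking

end ClosestPointProjection

/-! ### From strongly contracting on `X` to WPD on the contraction space. -/

section WeakProperDiscontinuity

open scoped Pointwise in
theorem zpow_smul_mem_of_image_eq {G X : Type*} [Group G] [MulAction G X] {g : G} {S : Set X}
    (h : (fun x => g • x) '' S = S) {x : X} (hx : x ∈ S) (n : ℤ) : g ^ n • x ∈ S := by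
  have hg : g ∈ MulAction.stabilizer G S := h
  have hn : g ^ n • S = S := Subgroup.zpow_mem _ hg n
  rw [← hn]
  exact Set.smul_mem_smul_set hx

variable {X : Type*} [MetricSpace X] {K : ℝ≥0 → ℝ≥0∞}

namespace PreContractionSpace

/-- The extension of a real function on `X` that is affine on the added intervals. -/
noncomputable def extend (ψ : X → ℝ) : PreContractionSpace K X → ℝ
  | point x => ψ x
  | edge e t => (1 - (t : ℝ)) * ψ e.1.1 + t * ψ e.1.2

theorem abs_extend_sub_le_of_walk {ψ : X → ℝ} {B : ℝ}
    (hlip : ∀ x y, |ψ x - ψ y| ≤ B * dist x y)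
    (hanti : ∀ x y, IsAntiContracting K x y → |ψ x - ψ y| ≤ B) {a b : PreContractionSpace K X}
    {l : ℝ} (h : Walk a b l) : |extend ψ a - extend ψ b| ≤ B * l := by
  have hglue : ∀ {a b : PreContractionSpace K X}, Glue a b → extend ψ a = extend ψ b := by
    rintro _ _ (e | e) <;> simp [extend]
  induction h with
  | nil a => simp
  | @inSpace x y b l _ ih =>
    have h1 := abs_sub_le (extend ψ (point x : PreContractionSpace K X))
      (extend ψ (point y : PreContractionSpace K X)) (extend ψ b)
    have h2 : |extend ψ (point x : PreContractionSpace K X) -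
      extend ψ (point y : PreContractionSpace K X)| ≤ B * dist x y := hlip x y
    linarith
  | @inEdge e s t b l _ ih =>
    have h1 := abs_sub_le (extend ψ (edge e s)) (extend ψ (edge e t)) (extend ψ b)
    have h2 : |extend ψ (edge e s) - extend ψ (edge e t)| ≤ B * dist s t := by
      have e1 : extend ψ (edge e s) - extend ψ (edge e t) =
          -(((s : ℝ) - t) * (ψ e.1.1 - ψ e.1.2)) := by simp only [extend]; ring
      rw [e1, abs_neg, abs_mul, Subtype.dist_eq, Real.dist_eq, mul_comm]
      exact mul_le_mul_of_nonneg_right (hanti _ _ e.2) (abs_nonneg _)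
    linarith
  | glue hg _ ih => rwa [hglue hg]
  | unglue hg _ ih => rwa [← hglue hg]

theorem abs_sub_le_dist {ψ : X → ℝ} {B : ℝ} (hB : 0 < B)
    (hlip : ∀ x y, |ψ x - ψ y| ≤ B * dist x y)
    (hanti : ∀ x y, IsAntiContracting K x y → |ψ x - ψ y| ≤ B) (x y : X) :
    |ψ x - ψ y| ≤ B * dist (point x : PreContractionSpace K X) (point y) := by
  rw [mul_comm, ← div_le_iff₀ hB]
  refine le_csInf (Walk.exists _ _) fun l hl => ?_
  rw [div_le_iff₀ hB, mul_comm]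
  exact abs_extend_sub_le_of_walk hlip hanti hl

end PreContractionSpace

variable {G : Type*} [Group G] [MulAction G X] [IsIsometricSMul G X] {g : G}

/-- A tracking map grows linearly along the orbit of a loxodromic element stabilising the
path. -/
theorem IsTracking.exists_lower_bound {A : ℝ} {γ : ℝ → X} {ψ : X → ℝ} (h : IsTracking A γ ψ)
    (hg : IsLoxodromic X g) (hS : (fun x => g • x) '' Set.range γ = Set.range γ) :
    ∃ C, 1 ≤ C ∧ ∀ m n : ℤ, |(m : ℝ) - n| / C - C ≤ |ψ (g ^ m • γ 0) - ψ (g ^ n • γ 0)| := by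
  have hA := h.one_le
  obtain ⟨C, hC, hb⟩ := hg.exists_bound (γ 0)
  have hcoarse : ∀ x ∈ Set.range γ, ∀ y ∈ Set.range γ,
      dist x y ≤ A * |ψ x - ψ y| + A * (2 * A) + A := by
    rintro _ ⟨s, rfl⟩ _ ⟨t, rfl⟩
    have h1 := h.dist_le s t
    have h2 := h.param s
    have h3 := h.param t
    have h4 := abs_sub_le t (ψ (γ t)) s
    have h5 := abs_sub_le (ψ (γ t)) (ψ (γ s)) s
    rw [abs_sub_comm t (ψ (γ t))] at h4
    rw [abs_sub_comm (ψ (γ t)) (ψ (γ s))] at h5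
    have h6 := mul_le_mul_of_nonneg_left (by linarith : |t - s| ≤ |ψ (γ s) - ψ (γ t)| + 2 * A)
      (by linarith : 0 ≤ A)
    linarith
  have hAC : 0 < A * C := by positivity
  refine ⟨A * C + (C + 2 * A + 1), by nlinarith, fun m n => ?_⟩
  have h1 := hcoarse _ (zpow_smul_mem_of_image_eq hS ⟨0, rfl⟩ m) _
    (zpow_smul_mem_of_image_eq hS ⟨0, rfl⟩ n)
  have h2 := (hb m n).1
  have h3 : |(m : ℝ) - n| / (A * C + (C + 2 * A + 1)) ≤ |(m : ℝ) - n| / (A * C) :=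
    div_le_div_of_nonneg_left (abs_nonneg _) hAC (by linarith)
  have h4 : |(m : ℝ) - n| / (A * C) = |(m : ℝ) - n| / C / A := by
    rw [div_div, mul_comm]
  have h5 : |(m : ℝ) - n| / C / A ≤ |ψ (g ^ m • γ 0) - ψ (g ^ n • γ 0)| + (C + 2 * A + 1) := by
    rw [div_le_iff₀ (by linarith)]
    nlinarith
  linarith

theorem isWPD_of_isStronglyContracting (hX : IsGeodesicSpace X)
    (hproper : ∀ (x : X) (R : ℝ), {g : G | dist x (g • x) ≤ R}.Finite)
    (hK : IsFullContractionGauge K) (h : IsStronglyContracting X g) :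
    IsWPD (ContractionSpace K X) g := by
  obtain ⟨hlox, C, γ, hγ, hcon, hS⟩ := h
  obtain ⟨φ, hφ⟩ := hγ.exists_isClosestParam hcon
  obtain ⟨ψ, hψ⟩ := hφ.exists_isTracking
  set A := 15 * C ^ 3
  have hA := hψ.one_le
  obtain ⟨B₀, hB₀⟩ := hψ.exists_abs_sub_le hX hK
  obtain ⟨E, hE, hlow⟩ := hψ.exists_lower_bound hlox hS
  set B := max A B₀ with hB
  have hB1 : 1 ≤ B := hA.trans (le_max_left _ _)
  have hψB : ∀ x y : X, |ψ x - ψ y| ≤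
      B * dist (PreContractionSpace.point x : PreContractionSpace K X)
        (PreContractionSpace.point y) :=
    PreContractionSpace.abs_sub_le_dist (by linarith)
      (fun x y => (hψ.lip x y).trans (mul_le_mul_of_nonneg_right (le_max_left _ _) dist_nonneg))
      fun x y hxy => (hB₀ x y hxy).trans (le_max_right _ _)
  set o := γ 0
  set o' : ContractionSpace K X := SeparationQuotient.mk (PreContractionSpace.point o) with ho'
  have hdist : ∀ a b : G, |ψ (a • o) - ψ (b • o)| ≤ B * dist (a • o') (b • o') :=
    fun a b => hψB _ _
  refine ⟨⟨o', B * E + E + dist o' (g • o'), ?_, fun m n => ⟨?_, ?_⟩⟩, fun y R hR => ?_⟩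
  · nlinarith [dist_nonneg (x := o') (y := g • o')]
  · have h1 := (hlow m n).trans (hdist (g ^ m) (g ^ n))
    have hd := dist_nonneg (x := o') (y := g • o')
    have hBE : 0 < B * E := by positivity
    have h2 : |(m : ℝ) - n| / (B * E + E + dist o' (g • o')) ≤ |(m : ℝ) - n| / (B * E) :=
      div_le_div_of_nonneg_left (abs_nonneg _) hBE (by linarith)
    have h3 : |(m : ℝ) - n| / (B * E) = |(m : ℝ) - n| / E / B := by rw [div_div, mul_comm]
    have h4 : |(m : ℝ) - n| / E / B ≤ dist (g ^ m • o') (g ^ n • o') + E := by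
      rw [div_le_iff₀ (by linarith)]
      nlinarith
    linarith
  · have h1 := dist_zpow_smul_le g o' m n
    have h2 : 0 ≤ (B * E + E) * |(m : ℝ) - n| := by positivity
    have hd := dist_nonneg (x := o') (y := g • o')
    have hBE : 0 < B * E := by positivity
    rw [add_mul]
    linarith
  · set R' := R + 2 * dist y o' with hR'
    have hR0 : 0 ≤ B * R' := by positivity
    -- `N` makes `ψ` differ so much at `o` and `g ^ N • o` that moving both values by `B * R'`
    -- leaves a margin `A` around the middle value. The term `2 * dist y o'` in `R'` accounts for
    -- the change of base point.
    obtain ⟨N, hN⟩ := exists_nat_ge (E * (2 * (B * R') + 2 * A + E))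
    have hfar : 2 * (B * R') + 2 * A ≤ |ψ o - ψ (g ^ N • o)| := by
      have h1 := hlow 0 N
      rw [zpow_zero, one_smul, zpow_natCast, Int.cast_zero, zero_sub, abs_neg, Int.cast_natCast,
        Nat.abs_cast] at h1
      have h2 : 2 * (B * R') + 2 * A + E ≤ N / E := by
        rw [le_div_iff₀ (by linarith), mul_comm]; exact hN
      linarith
    refine ⟨N, (hproper o (dist o (γ ((ψ o + ψ (g ^ N • o)) / 2)) + (A ^ 2 + 2 * A) +
      dist o (g ^ N • o))).subset ?_⟩
    rintro h ⟨h1, h2⟩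
    have hmove : ∀ a : G, dist (a • y) (h • a • y) < R →
        |ψ (a • o) - ψ (h • a • o)| ≤ B * R' := by
      intro a ha
      have t := dist_triangle4 (a • o') (a • y) (h • a • y) (h • a • o')
      rw [dist_smul, dist_smul, dist_smul, dist_comm o' y] at t
      have e := hdist a (h * a)
      rw [mul_smul, mul_smul] at e
      exact e.trans (mul_le_mul_of_nonneg_left (by linarith) (by linarith))
    have m1 := hmove 1 (by simpa using h1)
    have m2 := hmove (g ^ N) h2
    rw [one_smul] at m1
    obtain ⟨σ, hσ⟩ := hX o (g ^ N • o)
    have hσ' := hσ.smul h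
    -- `ψ` need not be equivariant: controlling its values at the ends of `h • σ` suffices. The
    -- point of `γ` approached does not depend on `h`, so the displacement of `o` by `h` is bounded.
    obtain ⟨t, ht, htd⟩ := hψ.exists_dist_le hσ'.1 (s := (ψ o + ψ (g ^ N • o)) / 2) (by
      rw [hσ.2.1, dist_smul, hσ.2.2]
      rw [abs_le] at m1 m2
      rcases le_abs.1 hfar with hf | hf
      · right; constructor <;> linarith
      · left; constructor <;> linarith)
    rw [dist_smul] at ht
    have d1 := hσ.1.dist_eq le_rfl ht.1 ht.2
    rw [hσ.2.1] at d1
    have d2 := dist_triangle4 o (γ ((ψ o + ψ (g ^ N • o)) / 2)) (h • σ t) (h • o)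
    rw [dist_comm (γ _) (h • σ t), dist_smul, dist_comm (σ t) o] at d2
    change dist o (h • o) ≤ _
    linarith [ht.2]

end WeakProperDiscontinuity

theorem mainTheorem2 {G : Type*} [Group G] {X : Type*} [MetricSpace X] [MulAction G X]
    [IsIsometricSMul G X] (hfg : Group.FG G) (hX : IsGeodesicSpace X)
    (hgeom : IsGeometricAction G X) (K : ℝ≥0 → ℝ≥0∞) (hK : IsFullContractionGauge K) (g : G) :
    List.TFAE
      [IsLoxodromic (ContractionSpace K X) g,
        IsWPD (ContractionSpace K X) g,
        IsStronglyContracting X g] := by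
  tfae_have 1 → 3 := isStronglyContracting_of_isLoxodromic hX hK.1
  tfae_have 3 → 2 := isWPD_of_isStronglyContracting hX hgeom.1 hK
  tfae_have 2 → 1 := fun h => h.1
  tfae_finish
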